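/- Let $(Q_i)_{i\in I}$ be a family of tractable binary polytopes. That is, for each $i$ the set $Q_i\subseteq\mathbb{R}^{m_i}$ is a polytope (possibly empty) with all vertices in $\{0,1\}^{m_i}$, described to an algorithm by $m_i$ (in unary) and a code $\langle i\rangle$, and both of the following problems can be solved in time polynomial in the encoding length of their input: (linear optimization) given the description of $Q_i$ and $c\in\mathbb{Q}^{m_i}$, find a point of $Q_i$ minimizing $c^\top z$ over $z\in Q_i$, or report that $Q_i=\emptyset$; (separation) given the description of $Q_i$ and $y\in\mathbb{Q}^{m_i}$, report that $y\in Q_i$, or find $h\in\mathbb{Q}^{m_i}$ with $h^\top y<h^\top q$ for all $q\in Q_i$. For $k\ge 1$ and $Q\subseteq\mathbb{R}^m$ let $L_{k,Q}$ be the set of binary $k\times m$ matrices whose rows $z_1,\dots,z_k\in\{0,1\}^m$ are in strictly increasing lexicographic order and all belong to $Q$, and let $Y_{k,Q}=\{\sum_{i=1}^k z_i : [z_1,\dots,z_k]^\top\in L_{k,Q}\}\subseteq\mathbb{Z}_+^m$. Then the inequalities $$x^\top A y+k\,\bar a^\top x\ \ge\ k b\qquad\text{for all } y\in Y_{k,Q_i}$$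 can be separated in polynomial time: there is an algorithm that, given the description of $Q_i$, an integer $k\ge1$ in unary, a number $n$, $A\in\mathbb{Q}^{n\times m_i}$, $\bar a\in\mathbb{Q}^n$, $b\in\mathbb{Q}$ and $x\in\mathbb{Q}^n$, runs in time polynomial in the encoding length of this input and either reports that $x$ satisfies all these inequalities or returns some $y\in Y_{k,Q_i}$ whose inequality is violated by $x$. -/

import Mathlib

namespace PolySep

/-! ### A model of computation with a step count

Programs act on finite binary trees whose leaves are rational numbers. They are built from
tree and arithmetic operations by sequencing, pairing, branching and loops. Time is measured in the
bit model: every operation is charged the number of bits of its operands and of its result, and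
copying or testing is charged the number of bits of the data involved. Each operation
can be carried out by a Turing machine in time polynomial in the number of bits charged for it, and
conversely, so polynomial time here is polynomial time on Turing machines. -/

/-- Binary trees with rational leaves. -/
inductive Data where
  | num (q : ℚ) : Data
  | pair (u v : Data) : Data

namespace Data

/-- The encoding length in bits. A rational `p / q` in lowest terms has length
`1 + ⌈log₂ (|p| + 1)⌉ + ⌈log₂ (q + 1)⌉`. -/
def size : Data → ℕ
  | num q => 1 + Nat.size q.num.natAbs + Nat.size q.den
  | pair u v => 1 + size u + size v

/-- A truth value as data: `1` for true and `0` for false. -/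
def ofBool (c : Bool) : Data := num (if c then 1 else 0)

/-- Lists, as nested pairs terminated by `0`. -/
def ofList : List Data → Data
  | [] => num 0
  | u :: l => pair u (ofList l)

/-- An optional output: `0` for "none", and a tagged value otherwise. -/
def ofOption : Option Data → Data
  | none => num 0
  | some u => pair (num 1) u

/-- A natural number in unary. -/
def unary (k : ℕ) : Data := ofList (List.replicate k (num 0))

/-- A rational vector, as the list of its entries. -/
def ofVec {n : ℕ} (c : Fin n → ℚ) : Data := ofList (List.ofFn fun j => num (c j))

/-- A rational matrix, as the list of its rows. -/
def ofMatrix {n m : ℕ} (A : Matrix (Fin n) (Fin m) ℚ) : Data :=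
  ofList (List.ofFn fun i => ofVec (A i))

end Data

open Data

/-- The elementary operations. -/
inductive Op where
  | id | fst | snd | isPair
  | const (q : ℚ)
  | add | sub | mul | div | le

/-- The result of an elementary operation, `none` if the operand has the wrong shape.
The arithmetic operations and the comparison act on a pair of numbers. -/
def Op.apply : Op → Data → Option Data
  | .id, v => some v
  | .fst, pair u _ => some u
  | .snd, pair _ v => some v
  | .isPair, pair _ _ => some (ofBool true)
  | .isPair, num _ => some (ofBool false)
  | .const q, _ => some (num q)
  | .add, pair (num a) (num b) => some (num (a + b))
  | .sub, pair (num a) (num b) => some (num (a - b))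
  | .mul, pair (num a) (num b) => some (num (a * b))
  | .div, pair (num a) (num b) => some (num (a / b))
  | .le, pair (num a) (num b) => some (ofBool (decide (a ≤ b)))
  | _, _ => none

/-- Programs. `seq f g` runs `f` and then `g` on its result, `fork f g` runs both on the same
input and pairs the results, `ite c f g` runs `f` or `g` according to the test `c`, and `loop c f`
runs `f` as long as the test `c` succeeds. -/
inductive Prog where
  | op (o : Op)
  | seq (f g : Prog)
  | fork (f g : Prog)
  | ite (c f g : Prog)
  | loop (c f : Prog)

/-- `Eval p v w t`: on input `v` the program `p` halts with output `w` after time `t`.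
A test succeeds if its result is not the number `0`. -/
inductive Eval : Prog → Data → Data → ℕ → Prop
  | op {o : Op} {v w : Data} (h : o.apply v = some w) : Eval (.op o) v w (v.size + w.size)
  | seq {f g : Prog} {u v w : Data} {s t : ℕ} (hf : Eval f v u s) (hg : Eval g u w t) :
      Eval (.seq f g) v w (s + t + 1)
  | fork {f g : Prog} {v a b : Data} {s t : ℕ} (hf : Eval f v a s) (hg : Eval g v b t) :
      Eval (.fork f g) v (pair a b) (s + t + v.size + 1)
  | ite_true {c f g : Prog} {v r w : Data} {s t : ℕ} (hc : Eval c v r s) (hr : r ≠ num 0)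
      (hf : Eval f v w t) : Eval (.ite c f g) v w (s + t + v.size + 1)
  | ite_false {c f g : Prog} {v w : Data} {s t : ℕ} (hc : Eval c v (num 0) s)
      (hg : Eval g v w t) : Eval (.ite c f g) v w (s + t + v.size + 1)
  | loop_stop {c f : Prog} {v : Data} {s : ℕ} (hc : Eval c v (num 0) s) :
      Eval (.loop c f) v v (s + v.size + 1)
  | loop_step {c f : Prog} {v r u w : Data} {s t t' : ℕ} (hc : Eval c v r s) (hr : r ≠ num 0)
      (hf : Eval f v u t) (hl : Eval (.loop c f) u w t') :
      Eval (.loop c f) v w (s + t + t' + v.size + 1)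

/-- Programs are deterministic: the output and the running time are determined by the input. -/
theorem Eval.unique {p : Prog} {v w w' : Data} {t t' : ℕ} (h : Eval p v w t)
    (h' : Eval p v w' t') : w = w' ∧ t = t' := by
  induction h generalizing w' t' with
  | op h => cases h' with | op h2 => simp_all
  | seq _ _ ih1 ih2 =>
    cases h' with
    | seq hf hg =>
      obtain ⟨rfl, rfl⟩ := ih1 hf
      obtain ⟨rfl, rfl⟩ := ih2 hg
      exact ⟨rfl, rfl⟩
  | fork _ _ ih1 ih2 =>
    cases h' with
    | fork hf hg =>
      obtain ⟨rfl, rfl⟩ := ih1 hf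
      obtain ⟨rfl, rfl⟩ := ih2 hg
      exact ⟨rfl, rfl⟩
  | ite_true _ hr _ ih1 ih2 =>
    cases h' with
    | ite_true hc _ hf =>
      obtain ⟨rfl, rfl⟩ := ih1 hc
      obtain ⟨rfl, rfl⟩ := ih2 hf
      exact ⟨rfl, rfl⟩
    | ite_false hc _ => exact absurd (ih1 hc).1 hr
  | ite_false _ _ ih1 ih2 =>
    cases h' with
    | ite_true hc hr _ => exact absurd (ih1 hc).1.symm hr
    | ite_false hc hg =>
      obtain ⟨-, rfl⟩ := ih1 hc
      obtain ⟨rfl, rfl⟩ := ih2 hg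
      exact ⟨rfl, rfl⟩
  | loop_stop _ ih1 =>
    cases h' with
    | loop_stop hc =>
      obtain ⟨-, rfl⟩ := ih1 hc
      exact ⟨rfl, rfl⟩
    | loop_step hc hr _ _ => exact absurd (ih1 hc).1.symm hr
  | loop_step _ hr _ _ ih1 ih2 ih3 =>
    cases h' with
    | loop_stop hc => exact absurd (ih1 hc).1 hr
    | loop_step hc _ hf hl =>
      obtain ⟨rfl, rfl⟩ := ih1 hc
      obtain ⟨rfl, rfl⟩ := ih2 hf
      obtain ⟨rfl, rfl⟩ := ih3 hl
      exact ⟨rfl, rfl⟩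

/-- The problem with instances `I`, encoded as `input i`, in which an answer to the instance `i` is
any `w` with `Answer i w`, is solved by some program in time polynomial in the encoding length. -/
def SolvableInPolyTime {I : Type*} (input : I → Data) (Answer : I → Data → Prop) : Prop :=
  ∃ (p : Prog) (P : Polynomial ℕ), ∀ i, ∃ (w : Data) (t : ℕ),
    Eval p (input i) w t ∧ t ≤ P.eval (input i).size ∧ Answer i w

/-! ### Tractable binary polytopes -/

/-- A polytope (the convex hull of finitely many points) with all its vertices in `{0,1}^m`. -/
def IsBinaryPolytope {m : ℕ} (Q : Set (Fin m → ℝ)) : Prop :=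
  (∃ S : Set (Fin m → ℝ), S.Finite ∧ Q = convexHull ℝ S) ∧
    ∀ z ∈ Q.extremePoints ℝ, ∀ j, z j = 0 ∨ z j = 1

/-- A rational vector as a real vector. -/
def toReal {m : ℕ} (z : Fin m → ℚ) : Fin m → ℝ := fun j => (z j : ℝ)

section Family

variable {ι : Type*} (code : ι → Data) (m : ι → ℕ) (Q : ∀ i, Set (Fin (m i) → ℝ))

/-- The description of the `i`-th polytope that is given to a program: its dimension in unary
and its code. -/
def descr (i : ι) : Data := pair (unary (m i)) (code i)

/-- Linear optimization over the family `Q` in polynomial time: given `i` and a rational `c`, find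
a point of `Q i` that minimizes `c` over `Q i`, or report that `Q i` is empty. -/
def OptimizableInPolyTime : Prop :=
  SolvableInPolyTime (I := Σ i, Fin (m i) → ℚ)
    (fun I => pair (descr code m I.1) (ofVec I.2))
    (fun I w =>
      (w = ofOption none ∧ Q I.1 = ∅) ∨
      ∃ z : Fin (m I.1) → ℚ, w = ofOption (some (ofVec z)) ∧ toReal z ∈ Q I.1 ∧
        ∀ q ∈ Q I.1, toReal I.2 ⬝ᵥ toReal z ≤ toReal I.2 ⬝ᵥ q)

/-- Separation over the family `Q` in polynomial time: given `i` and a rational point `y`, report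
that `y` is in `Q i`, or find a rational `h` with `h · y < h · q` for all `q` in `Q i`. -/
def SeparableInPolyTime : Prop :=
  SolvableInPolyTime (I := Σ i, Fin (m i) → ℚ)
    (fun I => pair (descr code m I.1) (ofVec I.2))
    (fun I w =>
      (w = ofOption none ∧ toReal I.2 ∈ Q I.1) ∨
      ∃ h : Fin (m I.1) → ℚ, w = ofOption (some (ofVec h)) ∧
        ∀ q ∈ Q I.1, toReal h ⬝ᵥ toReal I.2 < toReal h ⬝ᵥ q)

/-- `Q` is a family of tractable binary polytopes. -/
structure IsTractableBinary : Prop where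
  binary : ∀ i, IsBinaryPolytope (Q i)
  optimizable : OptimizableInPolyTime code m Q
  separable : SeparableInPolyTime code m Q

end Family

/-! ### The inequalities -/

/-- `L_{k,m}`: the binary `k × m` matrices with rows in (strictly) increasing lexicographic
order. -/
def L (k m : ℕ) : Set (Matrix (Fin k) (Fin m) ℕ) :=
  {z | (∀ i j, z i j = 0 ∨ z i j = 1) ∧ StrictMono fun i => toLex (z i)}

/-- `L_{k,Q} = L_{k,m} ∩ Q^k`. -/
def LQ (k : ℕ) {m : ℕ} (Q : Set (Fin m → ℝ)) : Set (Matrix (Fin k) (Fin m) ℕ) :=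
  {z ∈ L k m | ∀ i, (fun j => (z i j : ℝ)) ∈ Q}

/-- `Y_{k,Q}`: the sums of the rows of the matrices in `L_{k,Q}`. -/
def YQ (k : ℕ) {m : ℕ} (Q : Set (Fin m → ℝ)) : Set (Fin m → ℕ) :=
  {y | ∃ z ∈ LQ k Q, y = ∑ i, z i}

/-- An instance of the separation problem for the inequalities
`xᵀ A y + k āᵀ x ≥ k b` for all `y ∈ Y_{k,Q}`: a member `i` of the family, the rational data
`k ≥ 1`, `A`, `ā`, `b` of the inequalities, and the rational point `x` to be separated. -/
structure Instance {ι : Type*} (m : ι → ℕ) where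
  i : ι
  n : ℕ
  k : ℕ
  k_pos : 1 ≤ k
  A : Matrix (Fin n) (Fin (m i)) ℚ
  abar : Fin n → ℚ
  b : ℚ
  x : Fin n → ℚ

namespace Instance

variable {ι : Type*} {m : ι → ℕ}

/-- The encoding of an instance; the number `k` is written in unary. -/
def encode (code : ι → Data) (I : Instance m) : Data :=
  ofList [descr code m I.i, unary I.k, ofMatrix I.A, ofVec I.abar, num I.b, ofVec I.x]

/-- The point `x` satisfies the inequality `xᵀ A y + k āᵀ x ≥ k b`. -/
def Satisfies (I : Instance m) (y : Fin (m I.i) → ℕ) : Prop :=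
  I.x ⬝ᵥ I.A.mulVec (fun j => (y j : ℚ)) + I.k * (I.abar ⬝ᵥ I.x) ≥ I.k * I.b

/-- A correct answer: "none" if `x` satisfies all the inequalities, and otherwise
some `y ∈ Y_{k,Q}` whose inequality is violated by `x`. -/
def Answer (Q : ∀ i, Set (Fin (m i) → ℝ)) (I : Instance m) (w : Data) : Prop :=
  (w = ofOption none ∧ ∀ y ∈ YQ I.k (Q I.i), I.Satisfies y) ∨
  ∃ y ∈ YQ I.k (Q I.i), ¬ I.Satisfies y ∧ w = ofOption (some (ofVec fun j => (y j : ℚ)))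

end Instance

end PolySep

/-!
The inequalities can be separated by minimizing `c · y` over the sums `y` of `k` distinct vertices
of the polytope, where `c = xᵀ A`: a binary point of `Q` is a vertex of `Q`, and a set of `k`
distinct binary vectors is the same as a matrix with lexicographically increasing rows. So it
suffices to find `k` best vertices with respect to `c`, or to find that there are fewer than `k`
vertices. Optimization alone is enough for that, through a beam search over the prefixes of binary
vectors.

A prefix of length `j` is encoded by a vector `s` with entries `1` (the coordinate is fixed to `0`),
`-1` (it is fixed to `1`) and `0` (it is free). Its value is the minimum over all vertices `v` of
`c · v` plus a penalty `2 S + 1` for each coordinate in which `v` violates `s`, where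
`S ≥ ∑ |c_t|`; up to a constant this objective is linear in `v`, hence one call of the
optimization oracle computes the value (`isLeast_value`). A value never decreases when a prefix is
extended, and one of the two extensions has the same value (`isTreeValue_of_isLeast`). Therefore one
may keep only the best `k` prefixes of each length: a prefix that has been dropped is outperformed
by `k` prefixes that are kept (`of_notMem_beam`). At full length, the value is at most `S` if and
only if the prefix is a vertex, and then the value is `c · v` (`value_full`). This shows that the
search finds `k` best vertices, or all of them (`beam_spec`, `sumFound_spec`, `YQ_eq_empty`).

The running time is treated by means of the relation `PolyTime e f`: some program computes `f i`
from `e i` in polynomial time, uniformly in `i`. It is a preorder that is closed under pairing,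
arithmetic, case distinctions, reindexing and loops over lists with states of polynomial size
(`PolyTime.loop`, `PolyTime.fold`). The size of a state is bounded either directly or through
additive growth; for sums of rational numbers one uses that the bit length is subadditive up to a
constant (`bitLength_add_le`).
-/

namespace PolySep
open Data

/-! ### Bit lengths of rational numbers -/

/-- The bit length of a rational number: that of the larger one of numerator and denominator. In
contrast to `Data.size`, it grows additively under sums, up to a constant. -/
def bitLength (q : ℚ) : ℕ := Nat.size (max q.num.natAbs q.den)

theorem bitLength_le_iff {q : ℚ} {n : ℕ} :
    bitLength q ≤ n ↔ q.num.natAbs < 2 ^ n ∧ q.den < 2 ^ n := by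
  simp [bitLength, Nat.size_le]

theorem bitLength_le_size (q : ℚ) : bitLength q ≤ (num q).size := by
  rw [bitLength_le_iff, ← Nat.size_le, ← Nat.size_le, size]
  omega

theorem one_le_bitLength (q : ℚ) : 1 ≤ bitLength q := by
  rw [bitLength, Nat.one_le_iff_ne_zero, ← Nat.pos_iff_ne_zero, Nat.size_pos]
  exact lt_max_of_lt_right q.den_pos

theorem size_num_le (q : ℚ) : (num q).size ≤ 3 * bitLength q := by
  have h1 : Nat.size q.num.natAbs ≤ bitLength q := Nat.size_le_size (le_max_left _ _)
  have h2 : Nat.size q.den ≤ bitLength q := Nat.size_le_size (le_max_right _ _)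
  have := one_le_bitLength q
  rw [size]
  omega

/-- Reducing a fraction to lowest terms increases neither numerator nor denominator. -/
theorem natAbs_num_and_den_le {q : ℚ} {n d : ℤ} (hd : d ≠ 0) (h : q = n / d) :
    q.num.natAbs ≤ n.natAbs ∧ q.den ≤ d.natAbs := by
  obtain ⟨c, hn, hc⟩ := Rat.num_den_mk (q := q) hd (by rw [h, Rat.divInt_eq_div])
  have hc0 : 1 ≤ c.natAbs := by
    rw [Nat.one_le_iff_ne_zero]
    rintro h0
    rw [Int.natAbs_eq_zero] at h0
    simp [h0] at hc
    exact hd hc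
  constructor
  · rw [hn, Int.natAbs_mul]
    exact Nat.le_mul_of_pos_left _ hc0
  · rw [hc, Int.natAbs_mul]
    exact Nat.le_mul_of_pos_left _ hc0

theorem bitLength_add_le (a b : ℚ) : bitLength (a + b) ≤ bitLength a + bitLength b + 1 := by
  obtain ⟨ha, ha'⟩ := bitLength_le_iff.1 (le_refl (bitLength a))
  obtain ⟨hb, hb'⟩ := bitLength_le_iff.1 (le_refl (bitLength b))
  obtain ⟨h1, h2⟩ := natAbs_num_and_den_le (q := a + b) (n := a.num * b.den + b.num * a.den)
    (d := a.den * b.den) (by simp) (by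
      conv_lhs => rw [← Rat.num_div_den a, ← Rat.num_div_den b]
      rw [div_add_div _ _ (by simp) (by simp)]
      push_cast
      ring)
  have h3 := Int.natAbs_add_le (a.num * b.den) (b.num * a.den)
  simp only [Int.natAbs_mul, Int.natAbs_natCast] at h1 h2 h3
  have h4 := Nat.mul_lt_mul'' ha hb'
  have h5 := Nat.mul_lt_mul'' hb ha'
  have h6 := Nat.mul_lt_mul'' ha' hb'
  rw [mul_comm (2 ^ bitLength b)] at h5
  rw [bitLength_le_iff, pow_succ, pow_add]
  omega

theorem bitLength_mul_le (a b : ℚ) : bitLength (a * b) ≤ bitLength a + bitLength b := by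
  obtain ⟨ha, ha'⟩ := bitLength_le_iff.1 (le_refl (bitLength a))
  obtain ⟨hb, hb'⟩ := bitLength_le_iff.1 (le_refl (bitLength b))
  obtain ⟨h1, h2⟩ := natAbs_num_and_den_le (q := a * b) (n := a.num * b.num)
    (d := a.den * b.den) (by simp) (by
      conv_lhs => rw [← Rat.num_div_den a, ← Rat.num_div_den b]
      rw [div_mul_div_comm]
      push_cast
      rfl)
  simp only [Int.natAbs_mul, Int.natAbs_natCast] at h1 h2
  have h4 := Nat.mul_lt_mul'' ha hb
  have h6 := Nat.mul_lt_mul'' ha' hb'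
  rw [bitLength_le_iff, pow_add]
  omega

theorem bitLength_neg (a : ℚ) : bitLength (-a) = bitLength a := by
  simp [bitLength]

theorem bitLength_sub_le (a b : ℚ) : bitLength (a - b) ≤ bitLength a + bitLength b + 1 := by
  rw [sub_eq_add_neg, ← bitLength_neg b]
  exact bitLength_add_le _ _

theorem bitLength_sum_le {β : Type*} (s : Finset β) (f : β → ℚ) {B : ℕ}
    (h : ∀ r ∈ s, bitLength (f r) ≤ B) : bitLength (∑ r ∈ s, f r) ≤ s.card * (B + 1) + 1 := by
  classical
  induction s using Finset.induction_on with
  | empty => simp [bitLength]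
  | insert a s ha ih =>
    rw [Finset.sum_insert ha, Finset.card_insert_of_notMem ha]
    have h1 := bitLength_add_le (f a) (∑ r ∈ s, f r)
    have h2 := h a (Finset.mem_insert_self _ _)
    have h3 := ih fun r hr => h r (Finset.mem_insert_of_mem hr)
    rw [add_mul]
    omega

/-! ### Polynomial bounds -/

theorem eval_mono (P : Polynomial ℕ) : Monotone fun x => P.eval x := by
  intro a b h
  simp only [Polynomial.eval_eq_sum_range]
  gcongr

/-- `f` is bounded by a polynomial in `g`. -/
def PolyBdd {I : Type*} (g f : I → ℕ) : Prop := ∃ P : Polynomial ℕ, ∀ i, f i ≤ P.eval (g i)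

namespace PolyBdd

variable {I J : Type*} {f f' g h : I → ℕ}

theorem refl (g : I → ℕ) : PolyBdd g g := ⟨Polynomial.X, by simp⟩

theorem const (c : ℕ) : PolyBdd g fun _ => c := ⟨Polynomial.C c, by simp⟩

theorem add (hf : PolyBdd g f) (hf' : PolyBdd g f') : PolyBdd g fun i => f i + f' i := by
  obtain ⟨P, hP⟩ := hf
  obtain ⟨P', hP'⟩ := hf'
  exact ⟨P + P', fun i => by simpa using Nat.add_le_add (hP i) (hP' i)⟩

theorem mul (hf : PolyBdd g f) (hf' : PolyBdd g f') : PolyBdd g fun i => f i * f' i := by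
  obtain ⟨P, hP⟩ := hf
  obtain ⟨P', hP'⟩ := hf'
  exact ⟨P * P', fun i => by simpa using Nat.mul_le_mul (hP i) (hP' i)⟩

theorem mono (hf : PolyBdd g f) (h : ∀ i, f' i ≤ f i) : PolyBdd g f' := by
  obtain ⟨P, hP⟩ := hf
  exact ⟨P, fun i => (h i).trans (hP i)⟩

theorem of_le (h : ∀ i, f i ≤ g i) : PolyBdd g f := (refl g).mono h

theorem trans (hf : PolyBdd g f) (hh : PolyBdd f h) : PolyBdd g h := by
  obtain ⟨P, hP⟩ := hf
  obtain ⟨P', hP'⟩ := hh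
  refine ⟨P'.comp P, fun i => (hP' i).trans ?_⟩
  rw [Polynomial.eval_comp]
  exact eval_mono _ (hP i)

theorem comp (hf : PolyBdd g f) (φ : J → I) : PolyBdd (fun j => g (φ j)) fun j => f (φ j) := by
  obtain ⟨P, hP⟩ := hf
  exact ⟨P, fun j => hP _⟩

/-- A quantity that starts polynomially bounded and grows by a polynomial amount in each of
polynomially many steps stays polynomially bounded. -/
theorem of_add_le {s : I → ℕ → ℕ} {N B : I → ℕ} (h0 : PolyBdd g fun i => s i 0)
    (hN : PolyBdd g N) (hB : PolyBdd g B) (hs : ∀ i, ∀ j < N i, s i (j + 1) ≤ s i j + B i) :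
    PolyBdd (fun x : Σ i, Fin (N i + 1) => g x.1) fun x => s x.1 x.2 := by
  refine ((h0.add (hN.mul hB)).comp Sigma.fst).mono ?_
  rintro ⟨i, j, hj⟩
  have key : ∀ j ≤ N i, s i j ≤ s i 0 + j * B i := by
    intro j
    induction j with
    | zero => simp
    | succ j ih =>
      intro hj
      have := hs i j hj
      have := ih (by omega)
      rw [add_mul]
      omega
  exact (key j (Nat.le_of_lt_succ hj)).trans
    (Nat.add_le_add_left (Nat.mul_le_mul_right _ (Nat.le_of_lt_succ hj)) _)

end PolyBdd

/-! ### Polynomial-time reducibility of data -/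

theorem Data.two_le_size (v : Data) : 2 ≤ v.size := by
  induction v with
  | num q =>
    have : 0 < Nat.size q.den := Nat.size_pos.2 q.den_pos
    rw [size]
    omega
  | pair u v => rw [size]; omega

/-- The output is written within the running time, hence sizes of computed data are polynomially
bounded as soon as running times are. -/
theorem Eval.size_le {p : Prog} {v w : Data} {t : ℕ} (h : Eval p v w t) : w.size ≤ t := by
  induction h <;> (try simp only [size]) <;> omega

/-- `PolyTime e f`: some program computes `f i` from `e i` in polynomial time, uniformly in the
index `i`. The program need not halt on data other than the `e i`. -/
def PolyTime {I : Type*} (e f : I → Data) : Prop :=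
  ∃ (p : Prog) (t : I → ℕ), (∀ i, Eval p (e i) (f i) (t i)) ∧ PolyBdd (fun i => (e i).size) t

namespace PolyTime

variable {I J : Type*} {e f g h : I → Data}

theorem size_le (hf : PolyTime e f) : PolyBdd (fun i => (e i).size) fun i => (f i).size := by
  obtain ⟨p, t, hp, ht⟩ := hf
  exact ht.mono fun i => (hp i).size_le

theorem of_op (o : Op) (ho : ∀ i, o.apply (e i) = some (f i))
    (hf : PolyBdd (fun i => (e i).size) fun i => (f i).size) : PolyTime e f :=
  ⟨.op o, _, fun i => .op (ho i), (PolyBdd.refl _).add hf⟩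

theorem refl (e : I → Data) : PolyTime e e := of_op .id (fun _ => rfl) (PolyBdd.refl _)

theorem trans (hf : PolyTime e f) (hg : PolyTime f g) : PolyTime e g := by
  have hs := hf.size_le
  obtain ⟨p, t, hp, ht⟩ := hf
  obtain ⟨p', t', hp', ht'⟩ := hg
  exact ⟨.seq p p', _, fun i => .seq (hp i) (hp' i), (ht.add (hs.trans ht')).add (.const 1)⟩

theorem comp (hf : PolyTime e f) (φ : J → I) : PolyTime (fun j => e (φ j)) fun j => f (φ j) := by
  obtain ⟨p, t, hp, ht⟩ := hf
  exact ⟨p, _, fun j => hp (φ j), ht.comp φ⟩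

/-- What is computable from data at hand is computable, after a change of the index. -/
theorem lift {e' : J → Data} (hf : PolyTime e f) (φ : J → I)
    (he : PolyTime e' fun j => e (φ j)) : PolyTime e' fun j => f (φ j) :=
  he.trans (hf.comp φ)

theorem pair (hf : PolyTime e f) (hg : PolyTime e g) :
    PolyTime e fun i => .pair (f i) (g i) := by
  obtain ⟨p, t, hp, ht⟩ := hf
  obtain ⟨p', t', hp', ht'⟩ := hg
  exact ⟨.fork p p', _, fun i => .fork (hp i) (hp' i),
    ((ht.add ht').add (PolyBdd.refl _)).add (.const 1)⟩

theorem fst (hf : PolyTime e fun i => .pair (f i) (g i)) : PolyTime e f :=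
  hf.trans (of_op .fst (fun _ => rfl) (PolyBdd.of_le fun i => by simp only [size]; omega))

theorem snd (hf : PolyTime e fun i => .pair (f i) (g i)) : PolyTime e g :=
  hf.trans (of_op .snd (fun _ => rfl) (PolyBdd.of_le fun i => by simp only [size]; omega))

theorem const (q : ℚ) : PolyTime e fun _ => num q :=
  of_op (.const q) (fun i => by cases e i <;> rfl) (PolyBdd.const _)

/-- An arithmetic operation takes polynomial time, since the bit length of its result is linear in
the bit lengths of its operands. -/
theorem arith {a b c : I → ℚ} (o : Op) (ha : PolyTime e fun i => num (a i))
    (hb : PolyTime e fun i => num (b i))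
    (ho : ∀ i, o.apply (.pair (num (a i)) (num (b i))) = some (num (c i)))
    (hc : ∀ i, bitLength (c i) ≤ bitLength (a i) + bitLength (b i) + 1) :
    PolyTime e fun i => num (c i) := by
  refine (ha.pair hb).trans (of_op o ho ?_)
  refine ((PolyBdd.const 3).mul (PolyBdd.refl _)).mono fun i => ?_
  have h1 := bitLength_le_size (a i)
  have h2 := bitLength_le_size (b i)
  have h3 := size_num_le (c i)
  have h4 := hc i
  rw [size.eq_2]
  omega

theorem add {a b : I → ℚ} (ha : PolyTime e fun i => num (a i))
    (hb : PolyTime e fun i => num (b i)) : PolyTime e fun i => num (a i + b i) :=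
  arith .add ha hb (fun _ => rfl) fun _ => bitLength_add_le _ _

theorem sub {a b : I → ℚ} (ha : PolyTime e fun i => num (a i))
    (hb : PolyTime e fun i => num (b i)) : PolyTime e fun i => num (a i - b i) :=
  arith .sub ha hb (fun _ => rfl) fun _ => bitLength_sub_le _ _

theorem mul {a b : I → ℚ} (ha : PolyTime e fun i => num (a i))
    (hb : PolyTime e fun i => num (b i)) : PolyTime e fun i => num (a i * b i) :=
  arith .mul ha hb (fun _ => rfl) fun _ => (bitLength_mul_le _ _).trans (Nat.le_succ _)

theorem size_ofBool_le (c : Bool) : (ofBool c).size ≤ 3 := by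
  cases c <;> simp [ofBool, size]

theorem le {a b : I → ℚ} (ha : PolyTime e fun i => num (a i))
    (hb : PolyTime e fun i => num (b i)) :
    PolyTime e fun i => ofBool (decide (a i ≤ b i)) :=
  (ha.pair hb).trans
    (of_op .le (fun _ => rfl) ((PolyBdd.const 3).mono fun _ => size_ofBool_le _))

theorem ite {c : I → Bool} (hc : PolyTime e fun i => ofBool (c i)) (hf : PolyTime e f)
    (hg : PolyTime e g) : PolyTime e fun i => if c i then f i else g i := by
  obtain ⟨p, t, hp, ht⟩ := hc
  obtain ⟨p₁, t₁, hp₁, ht₁⟩ := hf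
  obtain ⟨p₂, t₂, hp₂, ht₂⟩ := hg
  refine ⟨.ite p p₁ p₂, fun i => t i + (if c i then t₁ i else t₂ i) + (e i).size + 1,
    fun i => ?_, (((ht.add (ht₁.add ht₂)).add (PolyBdd.refl _)).add (.const 1)).mono fun i => ?_⟩
  · have h := hp i
    dsimp only at h ⊢
    cases hi : c i <;> rw [hi] at h
    · exact .ite_false h (hp₂ i)
    · exact .ite_true h (by simp [ofBool]) (hp₁ i)
  · split <;> omega

/-- A loop that is run for polynomially many rounds, over states of polynomial size. -/
theorem loop {v : I → ℕ → Data} {N : I → ℕ}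
    (hc : PolyTime (fun x : Σ i, Fin (N i + 1) => v x.1 x.2)
      fun x => ofBool (decide (x.2 < N x.1)))
    (hf : PolyTime (fun x : Σ i, Fin (N i) => v x.1 x.2) fun x => v x.1 (x.2 + 1))
    (hN : PolyBdd (fun i => (v i 0).size) N)
    (hv : PolyBdd (fun x : Σ i, Fin (N i + 1) => (v x.1 0).size) fun x => (v x.1 x.2).size) :
    PolyTime (fun i => v i 0) fun i => v i (N i) := by
  obtain ⟨p, t, hp, ht⟩ := hc
  obtain ⟨q, s, hq, hs⟩ := hf
  obtain ⟨P, hP⟩ := (hv.trans ht).add hv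
  obtain ⟨P', hP'⟩ := (hv.comp fun x : Σ i, Fin (N i) =>
    (⟨x.1, ⟨x.2, by omega⟩⟩ : Σ i, Fin (N i + 1))).trans hs
  have key : ∀ i k j, j + k = N i → ∃ T, Eval (.loop p q) (v i j) (v i (N i)) T ∧
      T ≤ (k + 1) * (P.eval (v i 0).size + P'.eval (v i 0).size + 1) := by
    -- Induction on the number `k` of the remaining rounds: each costs at most the time of the test
    -- plus the size of the state (bounded by `P`), plus the time of the body (bounded by `P'`).
    intro i k
    induction k with
    | zero =>
      intro j hj
      have h1 := hp ⟨i, ⟨j, by omega⟩⟩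
      have h2 := hP ⟨i, ⟨j, by omega⟩⟩
      dsimp only at h1 h2
      rw [add_zero] at hj
      subst hj
      rw [decide_eq_false (lt_irrefl _)] at h1
      refine ⟨_, Eval.loop_stop h1, ?_⟩
      omega
    | succ k ih =>
      intro j hj
      obtain ⟨T, hT, hT'⟩ := ih (j + 1) (by omega)
      have h1 := hp ⟨i, ⟨j, by omega⟩⟩
      have h2 := hP ⟨i, ⟨j, by omega⟩⟩
      have h3 := hP' ⟨i, ⟨j, by omega⟩⟩
      dsimp only at h1 h2 h3
      refine ⟨_, .loop_step h1 ?_ (hq ⟨i, ⟨j, by omega⟩⟩) hT, ?_⟩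
      · simp [ofBool, show j < N i by omega]
      · rw [add_mul _ 1]
        omega
  choose T hT hT' using fun i => key i (N i) 0 (zero_add _)
  exact ⟨.loop p q, T, hT, ((hN.add (.const 1)).mul
    ((show PolyBdd _ _ from ⟨P, fun _ => le_rfl⟩).add
      (show PolyBdd _ _ from ⟨P', fun _ => le_rfl⟩) |>.add (.const 1))).mono hT'⟩

end PolyTime

/-! ### Lists and loops over lists -/

theorem reverse_take_succ {α : Type*} {l : List α} {j : ℕ} (h : j < l.length) :
    (l.take (j + 1)).reverse = l[j] :: (l.take j).reverse := by
  rw [List.take_succ_eq_append_getElem h, List.reverse_append, List.reverse_singleton,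
    List.singleton_append]

namespace Data

/-- The first component, `0` on a leaf. -/
def hd : Data → Data
  | num _ => num 0
  | pair u _ => u

/-- The second component, `0` on a leaf. -/
def tl : Data → Data
  | num _ => num 0
  | pair _ v => v

/-- The entry of a list at a position, `0` beyond the end of the list. -/
def nth (d : Data) (j : ℕ) : Data := hd (tl^[j] d)

/-- Whether the tree is not a leaf. -/
def isPair : Data → Bool
  | num _ => false
  | pair _ _ => true

theorem size_tl_le (d : Data) : (tl d).size ≤ d.size := by
  cases d with
  | num q =>
    have := two_le_size (num q)
    have h : (num 0).size = 2 := rfl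
    rwa [tl, h]
  | pair u v => simp only [tl, size]; omega

theorem size_hd_le (d : Data) : (hd d).size ≤ d.size := by
  cases d with
  | num q =>
    have := two_le_size (num q)
    have h : (num 0).size = 2 := rfl
    rwa [hd, h]
  | pair u v => simp only [hd, size]; omega

theorem size_iterate_tl_le (d : Data) (j : ℕ) : (tl^[j] d).size ≤ d.size := by
  induction j with
  | zero => rfl
  | succ j ih => rw [Function.iterate_succ_apply']; exact (size_tl_le _).trans ih

theorem length_le_size (l : List Data) : l.length ≤ (ofList l).size := by
  induction l with
  | nil => simp
  | cons u l ih => simp only [ofList, size, List.length_cons]; omega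

theorem size_drop_le (l : List Data) (j : ℕ) : (ofList (l.drop j)).size ≤ (ofList l).size := by
  induction l generalizing j with
  | nil => simp
  | cons u l ih =>
    cases j with
    | zero => rfl
    | succ j => rw [List.drop_succ_cons]; have := ih j; simp only [ofList, size]; omega

theorem size_le_size_of_mem {l : List Data} {u : Data} (h : u ∈ l) :
    u.size ≤ (ofList l).size := by
  induction l with
  | nil => simp at h
  | cons v l ih =>
    simp only [ofList, size]
    rcases List.mem_cons.1 h with rfl | h
    · omega
    · have := ih h; omega

theorem size_ofList_le {l : List Data} {B : ℕ} (h : ∀ u ∈ l, u.size ≤ B) :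
    (ofList l).size ≤ l.length * (B + 1) + 2 := by
  induction l with
  | nil => exact Nat.le_of_eq (by rw [List.length_nil, zero_mul]; rfl)
  | cons v l ih =>
    have h1 := ih fun u hu => h u (List.mem_cons_of_mem _ hu)
    have h2 := h v List.mem_cons_self
    simp only [ofList, size, List.length_cons, add_mul]
    omega

theorem iterate_tl_ofList (l : List Data) (j : ℕ) : tl^[j] (ofList l) = ofList (l.drop j) := by
  induction l generalizing j with
  | nil =>
    induction j with
    | zero => rfl
    | succ j ih =>
      rw [Function.iterate_succ_apply']
      simp only [List.drop_nil] at ih ⊢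
      rw [ih]
      rfl
  | cons u l ih =>
    cases j with
    | zero => rfl
    | succ j => rw [Function.iterate_succ_apply, List.drop_succ_cons]; exact ih j

theorem nth_ofList {l : List Data} {j : ℕ} (h : j < l.length) : nth (ofList l) j = l[j] := by
  rw [nth, iterate_tl_ofList, List.drop_eq_getElem_cons h]
  rfl

theorem nth_ofVec {n : ℕ} (a : Fin n → ℚ) (t : Fin n) : nth (ofVec a) t = num (a t) := by
  rw [ofVec, nth_ofList (by simp)]
  simp

theorem nth_num_zero (j : ℕ) : nth (num 0) j = num 0 := by
  rw [nth, Function.iterate_fixed rfl]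
  rfl

end Data

namespace PolyTime

variable {I J : Type*} {e f g h : I → Data}

theorem isPair (hf : PolyTime e f) : PolyTime e fun i => ofBool (f i).isPair :=
  hf.trans (of_op .isPair (fun i => by cases f i <;> rfl)
    ((PolyBdd.const 3).mono fun _ => size_ofBool_le _))

/-- The total versions `hd` and `tl` of the operations `fst` and `snd` are computed by a test for
the shape of the data. -/
theorem hd_or_tl {k : Data → Data} (o : Op) (h0 : ∀ q, k (num q) = num 0)
    (h1 : ∀ u v, o.apply (.pair u v) = some (k (.pair u v))) (hk : ∀ d, (k d).size ≤ d.size)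
    (hf : PolyTime e f) : PolyTime e fun i => k (f i) := by
  refine hf.trans ?_
  have key : ∀ d, ∃ t, Eval (.ite (.op .isPair) (.op o) (.op (.const 0))) d (k d) t ∧
      t ≤ 10 * d.size + 10 := by
    intro d
    have h3 : (num 0).size = 2 := rfl
    have h4 : (num 1).size = 3 := rfl
    cases d with
    | num q =>
      rw [h0]
      exact ⟨_, .ite_false (.op rfl) (.op rfl), by omega⟩
    | pair u v =>
      have := hk (.pair u v)
      exact ⟨_, .ite_true (r := num 1) (.op rfl) (by simp) (.op (h1 u v)), by omega⟩
  choose t ht ht' using key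
  exact ⟨_, _, fun i => ht (f i),
    (((PolyBdd.const 10).mul (.refl _)).add (.const 10)).mono fun i => ht' (f i)⟩

theorem hd (hf : PolyTime e f) : PolyTime e fun i => (f i).hd :=
  hd_or_tl .fst (fun _ => rfl) (fun _ _ => rfl) size_hd_le hf

theorem tl (hf : PolyTime e f) : PolyTime e fun i => (f i).tl :=
  hd_or_tl .snd (fun _ => rfl) (fun _ _ => rfl) size_tl_le hf

/-- A loop over a list, with access to the entry of a second list at the same position. The state
after `j` rounds is `s i j`. -/
theorem fold {N : I → ℕ} {a : ∀ i, Fin (N i) → Data} {d : I → Data} {s : I → ℕ → Data}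
    (ha : PolyTime e fun i => ofList (List.ofFn (a i))) (hd : PolyTime e d)
    (h0 : PolyTime e fun i => s i 0)
    (hs : PolyTime (fun x : Σ i, Fin (N i) => .pair (e x.1)
      (.pair (.pair (a x.1 x.2) (nth (d x.1) x.2)) (s x.1 x.2))) fun x => s x.1 (x.2 + 1))
    (hb : PolyBdd (fun x : Σ i, Fin (N i + 1) => (e x.1).size) fun x => (s x.1 x.2).size) :
    PolyTime e fun i => s i (N i) := by
  -- The loop keeps the input, the rests of the two lists and the state.
  set v : I → ℕ → Data := fun i j => .pair (e i)
    (.pair (.pair (ofList ((List.ofFn (a i)).drop j)) (Data.tl^[j] (d i))) (s i j)) with hv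
  have hN : PolyBdd (fun i => (e i).size) N :=
    ha.size_le.mono fun i => by simpa using length_le_size (List.ofFn (a i))
  have hle : PolyBdd (fun i => (v i 0).size) fun i => (e i).size :=
    .of_le fun i => by simp only [hv, size]; omega
  have hstart : PolyTime e fun i => v i 0 := (refl e).pair ((ha.pair hd).pair h0)
  have hrem {K : Type _} (φ : K → I × ℕ) : PolyTime (fun x => v (φ x).1 (φ x).2)
      fun x => ofList ((List.ofFn (a (φ x).1)).drop (φ x).2) := (refl _).snd.fst.fst
  have hcons : ∀ i (j : Fin (N i)), ofList ((List.ofFn (a i)).drop j) =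
      .pair (a i j) (ofList ((List.ofFn (a i)).drop (j + 1))) := by
    intro i j
    rw [List.drop_eq_getElem_cons (by simp)]
    simp [ofList]
  have hloop : PolyTime (fun i => v i 0) fun i => v i (N i) := by
    refine loop ?_ ?_ (hle.trans hN) ?_
    · convert! (hrem fun x : Σ i, Fin (N i + 1) => (x.1, x.2)).isPair using 3 with x
      obtain ⟨i, j, hj⟩ := x
      by_cases h : j < N i
      · simp [h, hcons i ⟨j, h⟩, Data.isPair]
      · have : (List.ofFn (a i)).drop j = [] := by simpa using h
        simp [h, this, ofList, Data.isPair]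
    · have hfirst : PolyTime (fun x : Σ i, Fin (N i) => v x.1 x.2) fun x =>
          .pair (a x.1 x.2) (ofList ((List.ofFn (a x.1)).drop (x.2 + 1))) := by
        convert! hrem fun x : Σ i, Fin (N i) => (x.1, x.2) using 2 with x
        exact (hcons _ _).symm
      have hd' : PolyTime (fun x : Σ i, Fin (N i) => v x.1 x.2) fun x =>
          Data.tl^[x.2] (d x.1) := (refl _).snd.fst.snd
      refine (refl _).fst.pair ((hfirst.snd.pair ?_).pair
        (((refl _).fst.pair ((hfirst.fst.pair hd'.hd).pair (refl _).snd.snd)).trans hs))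
      simp only [Function.iterate_succ_apply']
      exact hd'.tl
    · refine PolyBdd.mono (f := fun x => (v x.1 0).size + (ofList (List.ofFn (a x.1))).size +
        (d x.1).size + (s x.1 x.2).size) (.add (.add (.add (.refl _) ?_) ?_) ?_) ?_
      · exact (hle.trans ha.size_le).comp _
      · exact (hle.trans hd.size_le).comp _
      · exact PolyBdd.trans (hle.comp _) hb
      · rintro ⟨i, j⟩
        have h1 := size_drop_le (List.ofFn (a i)) j
        have h2 := size_iterate_tl_le (d i) j
        simp only [hv, size]
        omega
  exact (hstart.trans hloop).snd.snd

/-- Loops that collect their results by prepending produce them in reverse order. -/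
theorem reverse {l : I → List Data} (hl : PolyTime e fun i => ofList (l i)) :
    PolyTime e fun i => ofList (l i).reverse := by
  have h := fold (e := e) (N := fun i => (l i).length) (a := fun i t => (l i)[t])
    (d := fun _ => num 0) (s := fun i j => ofList ((l i).take j).reverse)
    (by simpa using hl) (const 0) (by simpa [ofList] using const 0) ?_ ?_
  · simpa using h
  · have : PolyTime (fun x : Σ i, Fin (l i).length => .pair (e x.1)
      (.pair (.pair ((l x.1)[x.2]) (nth (num 0) x.2)) (ofList ((l x.1).take x.2).reverse)))
      fun x => .pair ((l x.1)[x.2]) (ofList ((l x.1).take x.2).reverse) :=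
      (refl _).snd.fst.fst.pair (refl _).snd.snd
    convert! this using 2 with x
    rw [reverse_take_succ x.2.2]
    rfl
  · refine PolyBdd.of_add_le (g := fun i => (e i).size)
      (s := fun i j => (ofList ((l i).take j).reverse).size)
      (B := fun i => (ofList (l i)).size + 1) ((PolyBdd.const 2).mono fun i => ?_)
      (hl.size_le.mono fun i => length_le_size _) (hl.size_le.add (.const 1)) fun i j hj => ?_
    · exact Nat.le_of_eq (by simp [ofList]; rfl)
    · have := size_le_size_of_mem (List.getElem_mem hj)
      simp only [reverse_take_succ hj, ofList, size]
      omega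

/-- The list of the results of a computation on the entries of two lists at the same position. -/
theorem map {N : I → ℕ} {a b : ∀ i, Fin (N i) → Data} {d : I → Data}
    (ha : PolyTime e fun i => ofList (List.ofFn (a i))) (hd : PolyTime e d)
    (hs : PolyTime (fun x : Σ i, Fin (N i) => .pair (e x.1)
      (.pair (a x.1 x.2) (nth (d x.1) x.2))) fun x => b x.1 x.2) :
    PolyTime e fun i => ofList (List.ofFn (b i)) := by
  have hs' : PolyTime (fun x : Σ i, Fin (N i) => .pair (e x.1) (.pair
      (.pair (a x.1 x.2) (nth (d x.1) x.2)) (ofList ((List.ofFn (b x.1)).take x.2).reverse)))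
      fun x => b x.1 x.2 := ((refl _).fst.pair (refl _).snd.fst).trans hs
  have hN : PolyBdd (fun i => (e i).size) N :=
    ha.size_le.mono fun i => by simpa using length_le_size (List.ofFn (a i))
  have hn : PolyBdd (fun x : Σ i, Fin (N i) => (e x.1).size) fun x =>
      (Data.pair (e x.1) (.pair (a x.1 x.2) (nth (d x.1) x.2))).size := by
    refine PolyBdd.mono (f := fun x => (e x.1).size + (ofList (List.ofFn (a x.1))).size +
        (d x.1).size + 2) (.add (.add (.add (.refl _) (ha.size_le.comp _)) (hd.size_le.comp _))
          (.const 2)) ?_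
    rintro ⟨i, j⟩
    have h1 : (a i j).size ≤ _ := size_le_size_of_mem (l := List.ofFn (a i)) (by simp)
    have h2 := (size_hd_le _).trans (size_iterate_tl_le (d i) j)
    simp only [size, nth]
    omega
  obtain ⟨P, hP⟩ := hn.trans hs.size_le
  have h := fold (e := e) (a := a) (d := d)
    (s := fun i j => ofList ((List.ofFn (b i)).take j).reverse) ha hd
    (by simpa [ofList] using const 0) ?_ ?_
  · convert! h.reverse using 3 with i
    rw [List.reverse_reverse, List.take_of_length_le (by simp)]
  · convert! hs'.pair (refl _).snd.snd using 2 with x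
    rw [reverse_take_succ (by simp)]
    simp [ofList]
  · refine PolyBdd.of_add_le (g := fun i => (e i).size)
      (s := fun i j => (ofList ((List.ofFn (b i)).take j).reverse).size)
      (B := fun i => P.eval (e i).size + 1) ((PolyBdd.const 2).mono fun i => ?_)
      hN (.add ⟨P, fun _ => le_rfl⟩ (.const 1)) fun i j hj => ?_
    · exact Nat.le_of_eq (by simp [ofList]; rfl)
    · have := hP ⟨i, j, hj⟩
      rw [reverse_take_succ (by simpa using hj)]
      simp only [ofList, size, List.getElem_ofFn] at this ⊢
      omega

/-- The sum of the results of a computation on the entries of two lists at the same position. -/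
theorem sum {N : I → ℕ} {a : ∀ i, Fin (N i) → Data} {b : ∀ i, Fin (N i) → ℚ} {d : I → Data}
    (ha : PolyTime e fun i => ofList (List.ofFn (a i))) (hd : PolyTime e d)
    (hs : PolyTime (fun x : Σ i, Fin (N i) => .pair (e x.1)
      (.pair (a x.1 x.2) (nth (d x.1) x.2))) fun x => num (b x.1 x.2)) :
    PolyTime e fun i => num (∑ t, b i t) := by
  have hb := map (b := fun i t => num (b i t)) ha hd hs
  have h := fold (e := e) (a := fun i t => num (b i t)) (d := d)
    (s := fun i j => num (∑ t : Fin (N i) with t.1 < j, b i t)) hb hd ?_ ?_ ?_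
  · simpa using h
  · simpa using const 0
  · have : PolyTime (fun x : Σ i, Fin (N i) => .pair (e x.1)
      (.pair (.pair (num (b x.1 x.2)) (nth (d x.1) x.2))
        (num (∑ t : Fin (N x.1) with t.1 < x.2.1, b x.1 t))))
      fun x => num (b x.1 x.2 + ∑ t : Fin (N x.1) with t.1 < x.2.1, b x.1 t) :=
      (refl _).snd.fst.fst.add (refl _).snd.snd
    convert! this using 3 with x
    rw [← Finset.sum_insert (by simp)]
    congr 1
    ext t
    simp only [Finset.mem_filter, Finset.mem_univ, true_and, Finset.mem_insert, Fin.ext_iff]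
    omega
  · have hN : PolyBdd (fun i => (e i).size) N :=
      ha.size_le.mono fun i => by simpa using length_le_size (List.ofFn (a i))
    -- A direct bound on the partial sums: the size after a round is not bounded by the size
    -- before it plus a polynomial, but the bit length is.
    refine PolyBdd.mono (((PolyBdd.const 3).mul
      ((hN.mul (hb.size_le.add (.const 1))).add (.const 1))).comp Sigma.fst) ?_
    rintro ⟨i, j⟩
    refine (size_num_le _).trans (Nat.mul_le_mul_left 3 ?_)
    refine (bitLength_sum_le (B := (ofList (List.ofFn fun t => num (b i t))).size) _ _
      fun t _ => ?_).trans (Nat.add_le_add_right (Nat.mul_le_mul_right _ ?_) _)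
    · exact (bitLength_le_size _).trans (size_le_size_of_mem (by simp))
    · exact (Finset.card_le_univ _).trans (by simp)

end PolyTime

/-! ### Vector arithmetic in polynomial time -/

theorem ofVec_zero (n : ℕ) : ofVec (0 : Fin n → ℚ) = unary n := by
  simp [ofVec, unary, List.ofFn_const]

namespace PolyTime

variable {I : Type*} {e : I → Data}

/-- The vector `a + q b`; the vector `b` may be given by any list with the right entries, where
missing entries count as `0`. -/
theorem axpy {n : I → ℕ} {a b : ∀ i, Fin (n i) → ℚ} {q : I → ℚ} {d : I → Data}
    (ha : PolyTime e fun i => ofVec (a i)) (hq : PolyTime e fun i => num (q i))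
    (hd : PolyTime e d) (hb : ∀ i (t : Fin (n i)), nth (d i) t = num (b i t)) :
    PolyTime e fun i => ofVec fun t => a i t + q i * b i t := by
  refine map (a := fun i t => num (a i t)) ha hd (add (refl _).snd.fst (mul ?_ ?_))
  · exact hq.lift Sigma.fst (refl _).fst
  · simp only [← hb]
    exact (refl _).snd.snd

theorem dot {n : I → ℕ} {a b : ∀ i, Fin (n i) → ℚ} {d : I → Data}
    (ha : PolyTime e fun i => ofVec (a i)) (hd : PolyTime e d)
    (hb : ∀ i (t : Fin (n i)), nth (d i) t = num (b i t)) :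
    PolyTime e fun i => num (a i ⬝ᵥ b i) := by
  refine sum (a := fun i t => num (a i t)) ha hd (mul (refl _).snd.fst ?_)
  simp only [← hb]
  exact (refl _).snd.snd

/-- The sum of the vectors that result from a computation on the entries of two lists at the same
position. -/
theorem vecSum {N n : I → ℕ} {a : ∀ i, Fin (N i) → Data} {b : ∀ i, Fin (N i) → Fin (n i) → ℚ}
    {d : I → Data} (ha : PolyTime e fun i => ofList (List.ofFn (a i))) (hd : PolyTime e d)
    (hn : PolyTime e fun i => unary (n i))
    (hs : PolyTime (fun x : Σ i, Fin (N i) => .pair (e x.1)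
      (.pair (a x.1 x.2) (nth (d x.1) x.2))) fun x => ofVec (b x.1 x.2)) :
    PolyTime e fun i => ofVec (∑ t, b i t) := by
  have hb := map (b := fun i t => ofVec (b i t)) ha hd hs
  have h := fold (e := e) (a := fun i t => ofVec (b i t)) (d := d)
    (s := fun i j => ofVec (∑ t : Fin (N i) with t.1 < j, b i t)) hb hd ?_ ?_ ?_
  · simpa using h
  · simpa [ofVec_zero] using hn
  · have : PolyTime (fun x : Σ i, Fin (N i) => .pair (e x.1)
      (.pair (.pair (ofVec (b x.1 x.2)) (nth (d x.1) x.2))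
        (ofVec (∑ t : Fin (N x.1) with t.1 < x.2.1, b x.1 t))))
      fun x => ofVec fun u => b x.1 x.2 u + 1 *
        (∑ t : Fin (N x.1) with t.1 < x.2.1, b x.1 t) u :=
      axpy (refl _).snd.fst.fst (const 1) (refl _).snd.snd fun _ _ => nth_ofVec _ _
    convert! this using 3 with x
    funext u
    rw [one_mul, ← Pi.add_apply, ← Finset.sum_insert (by simp)]
    refine congrFun (Finset.sum_congr ?_ fun _ _ => rfl) u
    ext t
    simp only [Finset.mem_filter, Finset.mem_univ, true_and, Finset.mem_insert, Fin.ext_iff]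
    omega
  · have hN : PolyBdd (fun i => (e i).size) N :=
      ha.size_le.mono fun i => by simpa using length_le_size (List.ofFn (a i))
    have hn' : PolyBdd (fun i => (e i).size) n :=
      hn.size_le.mono fun i => by simpa [unary] using length_le_size (List.replicate (n i) (num 0))
    refine PolyBdd.mono ((((hn'.mul (((PolyBdd.const 3).mul
      ((hN.mul (hb.size_le.add (.const 1))).add (.const 1))).add (.const 1))).add
        (.const 2))).comp Sigma.fst) ?_
    rintro ⟨i, j⟩
    refine (size_ofList_le fun u hu => ?_).trans_eq (by rw [List.length_ofFn])
    obtain ⟨v, rfl⟩ := List.mem_ofFn.1 hu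
    refine (size_num_le _).trans (Nat.mul_le_mul_left 3 ?_)
    rw [Finset.sum_apply]
    refine (bitLength_sum_le (B := (ofList (List.ofFn fun t => ofVec (b i t))).size) _ _
      fun t _ => ?_).trans (Nat.add_le_add_right (Nat.mul_le_mul_right _ ?_) _)
    · exact (bitLength_le_size _).trans ((size_le_size_of_mem (by simp)).trans
        (size_le_size_of_mem (l := List.ofFn fun t => ofVec (b i t))
          (u := ofVec (b i t)) (by simp)))
    · exact (Finset.card_le_univ _).trans (by simp)

end PolyTime

/-! ### Keeping the best `k` elements of a list -/

section Beam

variable {α : Type*} (F : α → ℚ) (k : ℕ)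

/-- One round of the search for an element with the largest value of `F`: the first component is
the largest element so far, the second one lists the other ones. -/
def bubble (st : α × List α) (y : α) : α × List α :=
  if F st.1 ≤ F y then (y, st.1 :: st.2) else (st.1, y :: st.2)

/-- Add `x` to a list, and remove an element with the largest value of `F` if the list had `k`
elements already. -/
def push (K : List α) (x : α) : List α :=
  if k ≤ K.length then (K.foldl (bubble F) (x, [])).2 else x :: K

/-- The best `k` elements among the children `l s` and `r s` of the members `s` of a list. -/
def level (l r : α → α) (K : List α) : List α :=
  K.foldl (fun K' s => push F k (push F k K' (l s)) (r s)) []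

end Beam

/-- An object together with its value, as data. -/
def node {α : Type*} (F : α → ℚ) (enc : α → Data) (x : α) : Data := .pair (num (F x)) (enc x)

/-- A list of objects together with their values, as data. -/
def nodes {α : Type*} (F : α → ℚ) (enc : α → Data) (K : List α) : Data :=
  ofList (K.map (node F enc))

theorem nodes_eq_ofFn {α : Type*} (F : α → ℚ) (enc : α → Data) (K : List α) :
    nodes F enc K = ofList (List.ofFn fun t : Fin K.length => node F enc K[t]) := by
  rw [nodes]
  congr 1
  apply List.ext_getElem <;> simp

theorem size_node_le {α : Type*} (F : α → ℚ) (enc : α → Data) {K : List α} {x : α} (h : x ∈ K) :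
    (node F enc x).size ≤ (nodes F enc K).size :=
  size_le_size_of_mem (List.mem_map_of_mem h)

/-- The search for the largest element only moves data around, so the states grow additively. -/
theorem size_bubble {α : Type*} (F : α → ℚ) (enc : α → Data) (st : α × List α) (y : α) :
    (node F enc (bubble F st y).1).size + (nodes F enc (bubble F st y).2).size =
      (node F enc st.1).size + (nodes F enc st.2).size + (node F enc y).size + 1 := by
  rw [bubble]
  split <;> simp only [nodes, List.map_cons, ofList, size] <;> omega

theorem size_foldl_bubble {α : Type*} (F : α → ℚ) (enc : α → Data) (K : List α)
    (st : α × List α) :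
    (node F enc (K.foldl (bubble F) st).1).size + (nodes F enc (K.foldl (bubble F) st).2).size ≤
      (node F enc st.1).size + (nodes F enc st.2).size + (nodes F enc K).size := by
  induction K generalizing st with
  | nil => simp
  | cons y K ih =>
    have h1 := ih (bubble F st y)
    have h2 := size_bubble F enc st y
    have h3 : (nodes F enc (y :: K)).size = 1 + (node F enc y).size + (nodes F enc K).size := rfl
    rw [List.foldl_cons]
    omega

theorem size_push_le {α : Type*} (F : α → ℚ) (enc : α → Data) (k : ℕ) (K : List α) (x : α) :
    (nodes F enc (push F k K x)).size ≤ (nodes F enc K).size + (node F enc x).size + 2 := by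
  rw [push]
  split
  · have h1 := size_foldl_bubble F enc K (x, [])
    have h2 : (nodes F enc []).size = 2 := rfl
    dsimp only at h1
    omega
  · simp only [nodes, List.map_cons, ofList, size]
    omega

namespace PolyTime

variable {I : Type*} {e : I → Data} {α : I → Type*} {F : ∀ i, α i → ℚ} {enc : ∀ i, α i → Data}

/-- The length of a list, as a number. -/
theorem length {K : ∀ i, List (α i)} (hK : PolyTime e fun i => nodes (F i) (enc i) (K i)) :
    PolyTime e fun i => num ((K i).length : ℚ) := by
  simp only [nodes_eq_ofFn] at hK
  have := sum (b := fun _ _ => 1) hK (const 0) (const 1)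
  simpa using this

theorem push {K : ∀ i, List (α i)} {x : ∀ i, α i} {k : I → ℕ}
    (hK : PolyTime e fun i => nodes (F i) (enc i) (K i))
    (hx : PolyTime e fun i => node (F i) (enc i) (x i))
    (hk : PolyTime e fun i => num (k i : ℚ)) :
    PolyTime e fun i => nodes (F i) (enc i) (push (F i) (k i) (K i) (x i)) := by
  have hK' := hK
  simp only [nodes_eq_ofFn] at hK'
  let st : ∀ i, ℕ → α i × List (α i) := fun i j =>
    ((K i).take j).foldl (bubble (F i)) (x i, [])
  have hst : ∀ i (j : Fin (K i).length), st i (j + 1) = bubble (F i) (st i j) (K i)[j] := by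
    intro i j
    simp only [st, List.take_succ_eq_append_getElem j.2, List.foldl_append, List.foldl_cons,
      List.foldl_nil, Fin.getElem_fin]
  have hbubble := fold (e := e) (d := fun _ => num 0)
    (s := fun i j => .pair (node (F i) (enc i) (st i j).1) (nodes (F i) (enc i) (st i j).2))
    hK' (const 0) (hx.pair (const 0)) ?_ ?_
  · have := ite (hk.le hK.length) hbubble.snd (hx.pair hK)
    convert! this using 2 with i
    simp only [PolySep.push, Nat.cast_le, decide_eq_true_eq, st, List.take_length]
    split <;> rfl
  · have hy := (refl fun x : Σ i, Fin (K i).length => .pair (e x.1)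
      (.pair (.pair (node (F x.1) (enc x.1) (K x.1)[x.2]) (nth (num 0) x.2))
        (.pair (node (F x.1) (enc x.1) (st x.1 x.2).1)
          (nodes (F x.1) (enc x.1) (st x.1 x.2).2)))).snd.fst.fst
    have hc := (refl fun x : Σ i, Fin (K i).length => .pair (e x.1)
      (.pair (.pair (node (F x.1) (enc x.1) (K x.1)[x.2]) (nth (num 0) x.2))
        (.pair (node (F x.1) (enc x.1) (st x.1 x.2).1)
          (nodes (F x.1) (enc x.1) (st x.1 x.2).2)))).snd.snd
    convert! ite (hc.fst.fst.le hy.fst) (hy.pair (hc.fst.pair hc.snd))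
      (hc.fst.pair (hy.pair hc.snd)) using 2 with x
    rw [hst, bubble]
    simp only [decide_eq_true_eq]
    split <;> rfl
  · refine PolyBdd.mono (((hx.size_le.add (.const 3)).add hK.size_le).comp Sigma.fst) ?_
    rintro ⟨i, j⟩
    have h1 := size_foldl_bubble (F i) (enc i) ((K i).take j) (x i, [])
    have h2 : (nodes (F i) (enc i) []).size = 2 := rfl
    have h3 : (nodes (F i) (enc i) ((K i).take j)).size ≤ (nodes (F i) (enc i) (K i)).size := by
      have := List.take_append_drop j ((K i).map (node (F i) (enc i)))
      rw [nodes, nodes, List.map_take]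
      generalize (K i).map (node (F i) (enc i)) = l
      clear * -
      generalize j.1 = j
      induction l generalizing j with
      | nil => simp
      | cons u l ih =>
        cases j with
        | zero => exact two_le_size _
        | succ j => have := ih j; simp only [List.take_succ_cons, ofList, size]; omega
    simp only [size, st]
    dsimp only at h1
    omega

theorem level {K : ∀ i, List (α i)} {l r : ∀ i, α i → α i} {k : I → ℕ}
    (hK : PolyTime e fun i => nodes (F i) (enc i) (K i))
    (hl : PolyTime (fun x : Σ i, Fin (K i).length => .pair (e x.1)
      (node (F x.1) (enc x.1) (K x.1)[x.2])) fun x => node (F x.1) (enc x.1) (l x.1 (K x.1)[x.2]))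
    (hr : PolyTime (fun x : Σ i, Fin (K i).length => .pair (e x.1)
      (node (F x.1) (enc x.1) (K x.1)[x.2])) fun x => node (F x.1) (enc x.1) (r x.1 (K x.1)[x.2]))
    (hk : PolyTime e fun i => num (k i : ℚ)) :
    PolyTime e fun i => nodes (F i) (enc i) (level (F i) (k i) (l i) (r i) (K i)) := by
  have hK' := hK
  simp only [nodes_eq_ofFn] at hK'
  let st : ∀ i, ℕ → List (α i) := fun i j => ((K i).take j).foldl
    (fun K' s => PolySep.push (F i) (k i) (PolySep.push (F i) (k i) K' (l i s)) (r i s)) []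
  have hst : ∀ i (j : ℕ) (hj : j < (K i).length), st i (j + 1) = PolySep.push (F i) (k i)
      (PolySep.push (F i) (k i) (st i j) (l i (K i)[j])) (r i (K i)[j]) := by
    intro i j hj
    simp only [st, List.take_succ_eq_append_getElem hj, List.foldl_append, List.foldl_cons,
      List.foldl_nil]
  have hfold := fold (e := e) (d := fun _ => num 0)
    (s := fun i j => nodes (F i) (enc i) (st i j)) hK' (const 0) (const 0) ?_ ?_
  · simpa only [PolySep.level, st, List.take_length] using hfold
  · let e' := fun x : Σ i, Fin (K i).length => Data.pair (e x.1)
      (.pair (.pair (node (F x.1) (enc x.1) (K x.1)[x.2]) (nth (num 0) x.2))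
        (nodes (F x.1) (enc x.1) (st x.1 x.2)))
    have hn : PolyTime e' fun x => .pair (e x.1) (node (F x.1) (enc x.1) (K x.1)[x.2]) :=
      (refl e').fst.pair (refl e').snd.fst.fst
    have hk' := hk.lift Sigma.fst (refl e').fst
    simp only [hst _ _ (Fin.is_lt _)]
    exact push (push (refl e').snd.snd (hn.trans hl) hk') (hn.trans hr) hk'
  · have hsize : PolyBdd (fun x : Σ i, Fin (K i).length => (e x.1).size) fun x =>
        (Data.pair (e x.1) (node (F x.1) (enc x.1) (K x.1)[x.2])).size := by
      refine PolyBdd.mono (((PolyBdd.refl fun i => (e i).size).add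
        (hK.size_le.add (.const 1))).comp Sigma.fst) ?_
      rintro ⟨i, j⟩
      have : (node (F i) (enc i) (K i)[j]).size ≤ (nodes (F i) (enc i) (K i)).size :=
        size_node_le _ _ (List.getElem_mem _)
      simp only [size]
      omega
    obtain ⟨P, hP⟩ := hsize.trans hl.size_le
    obtain ⟨P', hP'⟩ := hsize.trans hr.size_le
    refine PolyBdd.of_add_le (g := fun i => (e i).size)
      (s := fun i j => (nodes (F i) (enc i) (st i j)).size)
      (B := fun i => P.eval (e i).size + P'.eval (e i).size + 4)
      ((PolyBdd.const 2).mono fun i => le_refl 2)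
      (hK.size_le.mono fun i => by
        simpa [nodes] using length_le_size ((K i).map (node (F i) (enc i))))
      (.add (.add ⟨P, fun _ => le_rfl⟩ ⟨P', fun _ => le_rfl⟩) (.const 4)) fun i j hj => ?_
    have h1 := size_push_le (F i) (enc i) (k i) (st i j) (l i (K i)[j])
    have h2 := size_push_le (F i) (enc i) (k i)
      (PolySep.push (F i) (k i) (st i j) (l i (K i)[j])) (r i (K i)[j])
    have h3 := hP ⟨i, j, hj⟩
    have h4 := hP' ⟨i, j, hj⟩
    rw [hst _ _ hj]
    dsimp only [Fin.getElem_fin] at h3 h4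
    omega

end PolyTime

/-! ### Correctness of the selection of the best elements -/

section Beam

variable {α : Type*} {F : α → ℚ} {k : ℕ}

/-- The list `K` consists of the best `k` elements of the list `l`, or of all of them. -/
def IsBest (F : α → ℚ) (k : ℕ) (K l : List α) : Prop :=
  ∃ R, (K ++ R).Perm l ∧ (∀ x ∈ K, ∀ y ∈ R, F x ≤ F y) ∧ K.length ≤ k ∧ (R ≠ [] → K.length = k)

theorem foldl_bubble_perm (K : List α) (st : α × List α) :
    ((K.foldl (bubble F) st).1 :: (K.foldl (bubble F) st).2).Perm (st.1 :: st.2 ++ K) := by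
  induction K generalizing st with
  | nil => simp
  | cons y K ih =>
    refine (ih _).trans ?_
    obtain ⟨x, l⟩ := st
    rw [bubble]
    split
    · exact (List.perm_middle (l₁ := x :: l)).symm
    · exact (List.perm_middle.symm).cons x

theorem foldl_bubble_le (K : List α) (st : α × List α) (h : ∀ y ∈ st.2, F y ≤ F st.1) :
    ∀ y ∈ (K.foldl (bubble F) st).2, F y ≤ F (K.foldl (bubble F) st).1 := by
  induction K generalizing st with
  | nil => simpa using h
  | cons y K ih =>
    refine ih _ ?_
    rw [bubble]
    split <;> grind

theorem IsBest.push {K l : List α} (h : IsBest F k K l) (x : α) :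
    IsBest F k (push F k K x) (x :: l) := by
  obtain ⟨R, hp, hle, hK, hR⟩ := h
  rw [PolySep.push]
  split
  · have h1 := foldl_bubble_perm (F := F) K (x, [])
    have h2 := foldl_bubble_le (F := F) K (x, []) (by simp)
    generalize K.foldl (bubble F) (x, []) = st at h1 h2
    obtain ⟨c, o⟩ := st
    simp only [List.cons_append, List.nil_append] at h1 h2 ⊢
    have hlen := h1.length_eq
    simp only [List.length_cons] at hlen
    refine ⟨c :: R, ?_, ?_, by omega, fun _ => by omega⟩
    · refine (List.perm_middle.trans ?_).trans (hp.cons x)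
      exact h1.append_right R
    · intro z hz y hy
      rcases List.mem_cons.1 hy with rfl | hy
      · exact h2 z hz
      · have hz' := h1.subset (List.mem_cons_of_mem c hz)
        rcases List.mem_cons.1 (h1.subset List.mem_cons_self) with rfl | hc
        · exact hle z (((List.perm_cons _).1 h1).subset hz) y hy
        · exact (h2 z hz).trans (hle c hc y hy)
  · rename_i hk
    have : R = [] := by
      by_contra h
      have := hR h
      omega
    subst this
    exact ⟨[], by simpa using hp, by simp, by simp; omega, by simp⟩

theorem IsBest.perm {K l l' : List α} (h : IsBest F k K l) (hl : l.Perm l') :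
    IsBest F k K l' := by
  obtain ⟨R, hp, h⟩ := h
  exact ⟨R, hp.trans hl, h⟩

/-- Pushing the children one by one selects the best `k` elements among all the children. -/
theorem isBest_level (l r : α → α) (K : List α) :
    IsBest F k (level F k l r K) (K.flatMap fun s => [l s, r s]) := by
  have key : ∀ K acc L : List α, IsBest F k acc L → IsBest F k
      (K.foldl (fun K' s => push F k (push F k K' (l s)) (r s)) acc)
      (K.flatMap (fun s => [l s, r s]) ++ L) := by
    intro K
    induction K with
    | nil => intro acc L h; simpa using h
    | cons s K ih =>
      intro acc L h
      refine (ih _ _ ((h.push (l s)).push (r s))).perm ?_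
      rw [List.flatMap_cons, List.append_assoc]
      exact (List.perm_append_comm_assoc _ [r s, l s] L).trans (List.Perm.swap _ _ _)
  simpa [level] using key K [] [] ⟨[], by simp⟩

theorem IsBest.subset {K l : List α} (h : IsBest F k K l) : K ⊆ l := by
  obtain ⟨R, hp, -⟩ := h
  exact fun x hx => hp.subset (List.mem_append_left R hx)

theorem IsBest.nodup {K l : List α} (h : IsBest F k K l) (hl : l.Nodup) : K.Nodup := by
  obtain ⟨R, hp, -⟩ := h
  exact (hp.nodup_iff.2 hl).of_append_left

theorem IsBest.length_le {K l : List α} (h : IsBest F k K l) : K.length ≤ k := by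
  obtain ⟨R, -, -, h, -⟩ := h
  exact h

/-- An element that is not selected is outperformed by `k` selected ones. -/
theorem IsBest.of_notMem {K l : List α} (h : IsBest F k K l) {p : α} (hp : p ∈ l) (hpK : p ∉ K) :
    K.length = k ∧ ∀ q ∈ K, F q ≤ F p := by
  obtain ⟨R, hperm, hle, -, hR⟩ := h
  have hpR : p ∈ R := by
    have := hperm.symm.subset hp
    simp only [List.mem_append, hpK, false_or] at this
    exact this
  exact ⟨hR (List.ne_nil_of_mem hpR), fun q hq => hle q hq p hpR⟩

/-- If `k` of the candidates have a value of at most `b`, then `k` elements are selected, and all of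
them have a value of at most `b`. -/
theorem IsBest.of_countP {K l : List α} (h : IsBest F k K l) {b : ℚ}
    (hb : k ≤ l.countP fun x => F x ≤ b) : K.length = k ∧ ∀ q ∈ K, F q ≤ b := by
  obtain ⟨R, hperm, hle, hK, hR⟩ := h
  rw [← hperm.countP_eq, List.countP_append] at hb
  have h1 := List.countP_le_length (l := K) (p := fun x => decide (F x ≤ b))
  constructor
  · by_contra hne
    have : R = [] := by
      by_contra h
      exact hne (hR h)
    subst this
    simp only [List.countP_nil] at hb
    omega
  · by_contra! hq
    obtain ⟨q, hq, hqb⟩ := hq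
    have h2 : R.countP (fun x => F x ≤ b) = 0 := by
      rw [List.countP_eq_zero]
      intro y hy
      simpa using hqb.trans_le (hle q hq y hy)
    have h3 : K.countP (fun x => F x ≤ b) = K.length := by omega
    rw [List.countP_eq_length] at h3
    exact absurd (by simpa using h3 q hq) (not_le.2 hqb)

end Beam

/-! ### The search tree of partial sign vectors -/

section Search

variable {n : ℕ}

/-- The vertices of level `j` of the search tree: sign vectors whose first `j` entries are `1` or
`-1`, and whose other entries are `0`. An entry `1` or `-1` prescribes that the entry of a
binary vector is `0` or `1`, respectively. -/
def IsPartial (j : ℕ) (s : Fin n → ℚ) : Prop :=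
  ∀ t : Fin n, (t.1 < j → s t = 1 ∨ s t = -1) ∧ (j ≤ t.1 → s t = 0)

/-- The unit vector in direction `j`. -/
def unit (n j : ℕ) : Fin n → ℚ := fun t => if t.1 = j then 1 else 0

/-- The child of a vertex of level `j` in which the entry `j`, which is `0` there, is set
to `q`. -/
def child (j : ℕ) (q : ℚ) (s : Fin n → ℚ) : Fin n → ℚ := fun t => s t + q * unit n j t

/-- The `j`-th level of the search tree, pruned to at most `k` vectors per level. -/
def beam (F : (Fin n → ℚ) → ℚ) (k : ℕ) : ℕ → List (Fin n → ℚ)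
  | 0 => [0]
  | j + 1 => level F k (child j 1) (child j (-1)) (beam F k j)

theorem IsPartial.child {j : ℕ} {s : Fin n → ℚ} (hs : IsPartial j s) {q : ℚ}
    (hq : q = 1 ∨ q = -1) : IsPartial (j + 1) (child j q s) := by
  intro t
  obtain ⟨h1, h2⟩ := hs t
  simp only [PolySep.child, unit]
  refine ⟨fun ht => ?_, fun ht => ?_⟩
  · rcases Nat.lt_succ_iff_lt_or_eq.1 ht with ht | ht
    · simpa [ht.ne] using h1 ht
    · simpa [ht, h2 ht.ge] using hq
  · simp [show t.1 ≠ j by omega, h2 (by omega)]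

theorem IsPartial.exists_parent {j : ℕ} (hj : j < n) {p : Fin n → ℚ} (hp : IsPartial (j + 1) p) :
    ∃ s, IsPartial j s ∧ (p = PolySep.child j 1 s ∨ p = PolySep.child j (-1) s) := by
  refine ⟨fun t => if t.1 < j then p t else 0, fun t => ⟨fun ht => ?_, fun ht => ?_⟩, ?_⟩
  · simpa [ht] using (hp t).1 (by omega)
  · simp [ht]
  · have key : p = PolySep.child j (p ⟨j, hj⟩) fun t => if t.1 < j then p t else 0 := by
      funext t
      simp only [PolySep.child, unit]
      rcases lt_trichotomy t.1 j with h | h | h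
      · simp [h, h.ne]
      · obtain rfl : t = ⟨j, hj⟩ := Fin.ext h
        simp
      · simp [h.not_gt, h.ne', (hp t).2 h]
    rcases (hp ⟨j, hj⟩).1 (Nat.lt_succ_self j) with h | h <;> rw [h] at key
    · exact .inl key
    · exact .inr key

theorem child_injective (j : ℕ) (q : ℚ) : Function.Injective (child (n := n) j q) := by
  intro s s' h
  funext t
  have := congrFun h t
  simpa [child] using this

theorem child_ne_child {j : ℕ} (hj : j < n) {s s' : Fin n → ℚ} (hs : IsPartial j s)
    (hs' : IsPartial j s') : child j 1 s ≠ child j (-1) s' := by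
  intro h
  have := congrFun h ⟨j, hj⟩
  simp only [child, unit, (hs ⟨j, hj⟩).2 le_rfl, (hs' ⟨j, hj⟩).2 le_rfl] at this
  norm_num at this

/-- The value of a vertex of the search tree is the least one of its children's values. -/
structure IsTreeValue (F : (Fin n → ℚ) → ℚ) : Prop where
  le_child_one : ∀ j < n, ∀ s, IsPartial j s → F s ≤ F (child j 1 s)
  le_child_neg_one : ∀ j < n, ∀ s, IsPartial j s → F s ≤ F (child j (-1) s)
  child_le : ∀ j < n, ∀ s, IsPartial j s → F (child j 1 s) ≤ F s ∨ F (child j (-1) s) ≤ F s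

theorem isPartial_of_mem_beam {F : (Fin n → ℚ) → ℚ} {k j : ℕ} {s : Fin n → ℚ}
    (hs : s ∈ beam F k j) : IsPartial j s := by
  induction j generalizing s with
  | zero => simp only [beam, List.mem_singleton] at hs; subst hs; intro t; simp
  | succ j ih =>
    have := (isBest_level _ _ _).subset hs
    simp only [List.mem_flatMap, List.mem_cons, List.not_mem_nil, or_false] at this
    obtain ⟨s', hs', rfl | rfl⟩ := this
    · exact (ih hs').child (.inl rfl)
    · exact (ih hs').child (.inr rfl)

theorem length_beam_le {F : (Fin n → ℚ) → ℚ} {k : ℕ} (hk : 1 ≤ k) (j : ℕ) :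
    (beam F k j).length ≤ k := by
  cases j with
  | zero => simpa [beam] using hk
  | succ j => exact (isBest_level _ _ _).length_le

theorem nodup_beam {F : (Fin n → ℚ) → ℚ} {k j : ℕ} (hj : j ≤ n) : (beam F k j).Nodup := by
  induction j with
  | zero => simp [beam]
  | succ j ih =>
    refine (isBest_level _ _ _).nodup ?_
    rw [List.nodup_flatMap]
    have hjn : j < n := hj
    refine ⟨fun s hs => ?_, (ih (by omega)).imp_of_mem ?_⟩
    · have hs' := isPartial_of_mem_beam hs
      simp [child_ne_child hjn hs' hs']
    · intro s s' hs hs' hne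
      have h1 := isPartial_of_mem_beam hs
      have h2 := isPartial_of_mem_beam hs'
      simp [Function.onFun, (child_injective j _).eq_iff, child_ne_child hjn h2 h1,
        (child_ne_child hjn h1 h2).symm, Ne.symm hne]

/-- Pruning is harmless: each vector that is missing in the pruned level is outperformed by `k`
vectors in it. If the parent of a missing vector is missing itself, then `k` vectors in the previous
level outperform the parent, and each of them has a child of the same value. -/
theorem of_notMem_beam {F : (Fin n → ℚ) → ℚ} (hF : IsTreeValue F) {k j : ℕ} (hj : j ≤ n)
    {p : Fin n → ℚ} (hp : IsPartial j p) (hpK : p ∉ beam F k j) :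
    (beam F k j).length = k ∧ ∀ q ∈ beam F k j, F q ≤ F p := by
  induction j generalizing p with
  | zero =>
    exact absurd (by simp only [beam, List.mem_singleton]; funext t; exact (hp t).2 (by simp)) hpK
  | succ j ih =>
    have hbest := isBest_level (F := F) (k := k) (child j 1) (child j (-1)) (beam F k j)
    obtain ⟨s, hs, hsp⟩ := hp.exists_parent (by omega)
    have hle : F s ≤ F p := by
      rcases hsp with rfl | rfl
      · exact hF.le_child_one j (by omega) s hs
      · exact hF.le_child_neg_one j (by omega) s hs
    by_cases hsK : s ∈ beam F k j
    · exact hbest.of_notMem (by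
        rw [List.mem_flatMap]
        exact ⟨s, hsK, by simpa using hsp⟩) hpK
    · obtain ⟨h1, h2⟩ := ih (by omega) hs hsK
      refine hbest.of_countP ?_
      have key : ∀ K : List (Fin n → ℚ), (∀ q ∈ K, IsPartial j q ∧ F q ≤ F p) →
          K.length ≤ (K.flatMap fun s => [child j 1 s, child j (-1) s]).countP
            fun x => F x ≤ F p := by
        intro K hK
        induction K with
        | nil => simp
        | cons q K ihK =>
          have h3 := ihK fun q hq => hK q (List.mem_cons_of_mem _ hq)
          obtain ⟨h4, h5⟩ := hK q List.mem_cons_self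
          rw [List.flatMap_cons, List.countP_append, List.length_cons]
          have h6 : 1 ≤ [child j 1 q, child j (-1) q].countP fun x => F x ≤ F p := by
            rw [Nat.one_le_iff_ne_zero, ← Nat.pos_iff_ne_zero, List.countP_pos_iff]
            rcases hF.child_le j (by omega) q h4 with h | h
            · exact ⟨_, List.mem_cons_self, by simpa using h.trans h5⟩
            · exact ⟨_, List.mem_cons_of_mem _ List.mem_cons_self, by simpa using h.trans h5⟩
          omega
      refine h1.ge.trans ?_
      exact key _ fun q hq => ⟨isPartial_of_mem_beam hq, (h2 q hq).trans hle⟩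

end Search

/-! ### Penalized objectives -/

section Penalty

variable {n : ℕ}

/-- The vertices of a binary polytope, as rational vectors. -/
def vertices (Q : Set (Fin n → ℝ)) : Set (Fin n → ℚ) :=
  {v | (∀ t, v t = 0 ∨ v t = 1) ∧ toReal v ∈ Q}

theorem toReal_dotProduct (c v : Fin n → ℚ) : toReal c ⬝ᵥ toReal v = ((c ⬝ᵥ v : ℚ) : ℝ) := by
  simp [toReal, dotProduct]

/-- A linear functional attains its minimum over a binary polytope at a vertex. -/
theorem IsBinaryPolytope.exists_vertex_le {Q : Set (Fin n → ℝ)} (hQ : IsBinaryPolytope Q)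
    (c : Fin n → ℚ) {z : Fin n → ℚ} (hz : toReal z ∈ Q) :
    ∃ v ∈ vertices Q, c ⬝ᵥ v ≤ c ⬝ᵥ z := by
  obtain ⟨⟨S, hS, hQS⟩, hbin⟩ := hQ
  have hfin : (Q.extremePoints ℝ).Finite := hS.subset (by
    rw [hQS]
    exact extremePoints_convexHull_subset (𝕜 := ℝ))
  -- Krein-Milman; the closure is superfluous as there are finitely many extreme points.
  have hhull : convexHull ℝ (Q.extremePoints ℝ) = Q := by
    rw [← (hfin.isClosed_convexHull (𝕜 := ℝ)).closure_eq]
    refine closure_convexHull_extremePoints ?_ ?_ <;> rw [hQS]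
    · exact hS.isCompact_convexHull ℝ
    · exact convex_convexHull ℝ S
  have hex : ∃ v ∈ Q.extremePoints ℝ, toReal c ⬝ᵥ v ≤ toReal c ⬝ᵥ toReal z := by
    by_contra! h
    have hsub := convexHull_min (s := Q.extremePoints ℝ)
      (t := {w | toReal c ⬝ᵥ toReal z < toReal c ⬝ᵥ w}) h
      (convex_halfSpace_gt (𝕜 := ℝ)
        ⟨fun x y => dotProduct_add _ x y, fun a x => dotProduct_smul a _ x⟩ _)
    rw [hhull] at hsub
    exact lt_irrefl (toReal c ⬝ᵥ toReal z) (hsub hz)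
  obtain ⟨v, hv, hvz⟩ := hex
  have hvr : toReal (fun t => if v t = 1 then (1 : ℚ) else 0) = v := by
    funext t
    rcases hbin v hv t with h | h <;> simp [toReal, h]
  refine ⟨fun t => if v t = 1 then 1 else 0, ⟨fun t => ?_, ?_⟩, ?_⟩
  · dsimp only
    split
    · exact .inr rfl
    · exact .inl rfl
  · rw [hvr]
    exact hv.1
  · rw [← hvr, toReal_dotProduct, toReal_dotProduct] at hvz
    exact_mod_cast hvz

/-- An upper bound for the absolute value of `c · v` at all binary vectors `v`. Each summand bounds
`|c t|`, and it is computed without a case distinction. -/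
def bound (c : Fin n → ℚ) : ℚ := ∑ t, (c t * c t + 1)

/-- The objective `c` with a penalty for each entry that differs from the one prescribed
by `s`, up to an additive constant. The penalty `2 * bound c + 1` exceeds the difference of any two
values of `c` at binary vectors. -/
def penalized (c s : Fin n → ℚ) : Fin n → ℚ := fun t => c t + (2 * bound c + 1) * s t

/-- The additive constant of the penalized objective. -/
def offset (c s : Fin n → ℚ) : ℚ := ∑ t, (2 * bound c + 1) * ((s t * s t - s t) * (1 / 2))

/-- The number of entries of a binary vector `v` that differ from those prescribed by the partial
sign vector `s`. -/
def mismatch (s v : Fin n → ℚ) : ℚ := ∑ t, (s t * v t + (s t * s t - s t) * (1 / 2))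

/-- The value of the penalized objective at `v`. -/
def objective (c s v : Fin n → ℚ) : ℚ := penalized c s ⬝ᵥ v + offset c s

theorem objective_eq (c s v : Fin n → ℚ) :
    objective c s v = c ⬝ᵥ v + (2 * bound c + 1) * mismatch s v := by
  simp only [objective, penalized, offset, mismatch, dotProduct, Finset.mul_sum,
    ← Finset.sum_add_distrib]
  exact Finset.sum_congr rfl fun t _ => by ring

theorem bound_nonneg (c : Fin n → ℚ) : 0 ≤ bound c :=
  Finset.sum_nonneg fun t _ => by nlinarith [mul_self_nonneg (c t)]

theorem abs_dotProduct_le_bound (c : Fin n → ℚ) {v : Fin n → ℚ} (hv : ∀ t, v t = 0 ∨ v t = 1) :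
    |c ⬝ᵥ v| ≤ bound c := by
  refine (Finset.abs_sum_le_sum_abs _ _).trans (Finset.sum_le_sum fun t _ => ?_)
  rcases hv t with h | h <;> rw [h]
  · rw [mul_zero, abs_zero]
    nlinarith [mul_self_nonneg (c t)]
  · rw [mul_one]
    exact abs_le.2 ⟨by nlinarith [mul_self_nonneg (c t + 1)],
      by nlinarith [mul_self_nonneg (c t - 1)]⟩

/-- Setting the entry `j` to `1` or `-1` adds `v j` or `1 - v j` to the number of mismatches. -/
theorem mismatch_child {j : ℕ} (hj : j < n) {s : Fin n → ℚ} (hs : IsPartial j s) (q : ℚ)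
    (v : Fin n → ℚ) :
    mismatch (child j q s) v = mismatch s v + (q * v ⟨j, hj⟩ + (q * q - q) * (1 / 2)) := by
  have : ∀ t : Fin n, child j q s t * v t + (child j q s t * child j q s t - child j q s t) *
      (1 / 2) = (s t * v t + (s t * s t - s t) * (1 / 2)) +
        if t = ⟨j, hj⟩ then q * v t + (q * q - q) * (1 / 2) else 0 := by
    intro t
    by_cases h : t = ⟨j, hj⟩
    · subst h
      simp [child, unit, (hs ⟨j, hj⟩).2 le_rfl]
    · have h' : t.1 ≠ j := fun h' => h (Fin.ext h')
      simp [child, unit, h, h']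
  rw [mismatch, Finset.sum_congr rfl fun t _ => this t, Finset.sum_add_distrib]
  simp [mismatch]

/-- The least values of the penalized objectives are compatible with the search tree: passing to a
child never removes a penalty, and an optimal vertex agrees with one of the two children. -/
theorem isTreeValue_of_isLeast {c : Fin n → ℚ} {V : Set (Fin n → ℚ)}
    (hV : ∀ v ∈ V, ∀ t, v t = 0 ∨ v t = 1) {F : (Fin n → ℚ) → ℚ}
    (hF : ∀ s, IsLeast (objective c s '' V) (F s)) : IsTreeValue F := by
  have hc := bound_nonneg c
  have key : ∀ j (hj : j < n) s, IsPartial j s → ∀ q v, objective c (child j q s) v =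
      objective c s v + (2 * bound c + 1) * (q * v ⟨j, hj⟩ + (q * q - q) * (1 / 2)) := by
    intro j hj s hs q v
    rw [objective_eq, objective_eq, mismatch_child hj hs]
    ring
  refine ⟨fun j hj s hs => ?_, fun j hj s hs => ?_, fun j hj s hs => ?_⟩
  · obtain ⟨v, hv, hv'⟩ := (hF (child j 1 s)).1
    rw [← hv', key j hj s hs]
    refine ((hF s).2 ⟨v, hv, rfl⟩).trans (le_add_of_nonneg_right ?_)
    rcases hV v hv ⟨j, hj⟩ with h | h <;> rw [h] <;> nlinarith
  · obtain ⟨v, hv, hv'⟩ := (hF (child j (-1) s)).1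
    rw [← hv', key j hj s hs]
    refine ((hF s).2 ⟨v, hv, rfl⟩).trans (le_add_of_nonneg_right ?_)
    rcases hV v hv ⟨j, hj⟩ with h | h <;> rw [h] <;> nlinarith
  · obtain ⟨v, hv, hv'⟩ := (hF s).1
    rcases hV v hv ⟨j, hj⟩ with h | h
    · refine .inl (((hF _).2 ⟨v, hv, rfl⟩).trans ?_)
      rw [← hv', key j hj s hs, h]
      norm_num
    · refine .inr (((hF _).2 ⟨v, hv, rfl⟩).trans ?_)
      rw [← hv', key j hj s hs, h]
      norm_num

/-- The binary vector that is prescribed by a sign vector. -/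
def vert (s : Fin n → ℚ) : Fin n → ℚ := fun t => (1 - s t) * (1 / 2)

theorem vert_injective : Function.Injective (vert (n := n)) := by
  intro s s' h
  funext t
  have := congrFun h t
  simp only [vert] at this
  linarith

theorem exists_vert_eq {v : Fin n → ℚ} (hv : ∀ t, v t = 0 ∨ v t = 1) :
    ∃ s, IsPartial n s ∧ vert s = v := by
  refine ⟨fun t => 1 - 2 * v t, fun t => ⟨fun _ => ?_, fun h => absurd t.2 h.not_gt⟩, ?_⟩
  · rcases hv t with h | h <;> norm_num [h]
  · funext t
    simp only [vert]
    ring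

theorem mismatch_vert {s : Fin n → ℚ} (hs : IsPartial n s) : mismatch s (vert s) = 0 := by
  refine Finset.sum_eq_zero fun t _ => ?_
  rcases (hs t).1 t.2 with h | h <;> norm_num [vert, h]

theorem one_le_mismatch {s v : Fin n → ℚ} (hs : IsPartial n s) (hv : ∀ t, v t = 0 ∨ v t = 1)
    (h : v ≠ vert s) : 1 ≤ mismatch s v := by
  obtain ⟨t, ht⟩ := Function.ne_iff.1 h
  have hnn : ∀ u ∈ Finset.univ, 0 ≤ s u * v u + (s u * s u - s u) * (1 / 2) := by
    intro u _
    rcases (hs u).1 u.2 with h | h <;> rcases hv u with h' | h' <;> norm_num [h, h']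
  refine le_trans ?_ (Finset.single_le_sum hnn (Finset.mem_univ t))
  rw [vert] at ht
  rcases (hs t).1 t.2 with h | h <;> rcases hv t with h' | h' <;>
    first
    | rw [h, h']; norm_num; done
    | exact absurd (by rw [h, h']; norm_num) ht

/-- On the last level of the search tree, the values that do not exceed the bound are those of the
vertices, and there they are the values of the original objective. -/
theorem value_full {c : Fin n → ℚ} {V : Set (Fin n → ℚ)}
    (hV : ∀ v ∈ V, ∀ t, v t = 0 ∨ v t = 1) {b : ℚ} {s : Fin n → ℚ}
    (hb : IsLeast (objective c s '' V) b) (hs : IsPartial n s) :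
    (b ≤ bound c ↔ vert s ∈ V) ∧ (vert s ∈ V → b = c ⬝ᵥ vert s) := by
  have hc := bound_nonneg c
  obtain ⟨⟨v, hv, hvb⟩, hmin⟩ := hb
  have h1 := abs_le.1 (abs_dotProduct_le_bound c (hV v hv))
  have hcase : vert s ∈ V → b = c ⬝ᵥ vert s := by
    intro hsV
    have h2 := hmin ⟨_, hsV, rfl⟩
    have h3 := abs_le.1 (abs_dotProduct_le_bound c (hV _ hsV))
    rw [objective_eq, mismatch_vert hs] at h2
    refine le_antisymm (by linarith) ?_
    by_cases h : v = vert s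
    · rw [← hvb, objective_eq, h, mismatch_vert hs]
      simp
    · have := one_le_mismatch hs (hV v hv) h
      rw [← hvb, objective_eq]
      nlinarith
  refine ⟨⟨fun hle => ?_, fun hsV => ?_⟩, hcase⟩
  · by_contra hsV
    have := one_le_mismatch hs (hV v hv) fun h => hsV (h ▸ hv)
    rw [← hvb, objective_eq] at hle
    nlinarith
  · rw [hcase hsV]
    exact (abs_le.1 (abs_dotProduct_le_bound c (hV _ hsV))).2

/-- The outcome of the search: the members of the last level that are vertices are
`k` best vertices, or all the vertices. -/
theorem beam_spec {c : Fin n → ℚ} {V : Set (Fin n → ℚ)}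
    (hV : ∀ v ∈ V, ∀ t, v t = 0 ∨ v t = 1) {F : (Fin n → ℚ) → ℚ}
    (hF : ∀ s, IsLeast (objective c s '' V) (F s)) {k : ℕ} (hk : 1 ≤ k) :
    ∃ W : Finset (Fin n → ℚ), (↑W ⊆ V) ∧
      W.card = (beam F k n).countP (fun s => F s ≤ bound c) ∧
      (∀ v ∈ V, v ∉ W → W.card = k ∧ ∀ w ∈ W, c ⬝ᵥ w ≤ c ⬝ᵥ v) ∧
      (W.card = k → ∑ w ∈ W, w = ((beam F k n).map vert).sum) := by
  set K := beam F k n with hK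
  set K' := K.filter fun s => F s ≤ bound c with hK'
  have hnodup : (K'.map vert).Nodup := ((nodup_beam le_rfl).filter _).map vert_injective
  have hmem : ∀ w, w ∈ (K'.map vert).toFinset ↔ ∃ s ∈ K, F s ≤ bound c ∧ vert s = w := by
    simp [hK', and_assoc]
  have hlen := length_beam_le (F := F) hk n
  have hcard : (K'.map vert).toFinset.card = K.countP fun s => F s ≤ bound c := by
    rw [List.toFinset_card_of_nodup hnodup, List.length_map, List.countP_eq_length_filter]
  have hall : K.length = k → (∀ s ∈ K, F s ≤ bound c) → (K'.map vert).toFinset.card = k := by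
    intro h1 h2
    rw [hcard, List.countP_eq_length.2 (by simpa using h2), h1]
  refine ⟨(K'.map vert).toFinset, ?_, hcard, ?_, ?_⟩
  · intro w hw
    obtain ⟨s, hs, hsb, rfl⟩ := (hmem w).1 hw
    exact (value_full hV (hF s) (isPartial_of_mem_beam hs)).1.1 hsb
  · intro v hv hvW
    obtain ⟨p, hp, rfl⟩ := exists_vert_eq (hV v hv)
    obtain ⟨hp1, hp2⟩ := value_full hV (hF p) hp
    have hpK : p ∉ K := fun h => hvW ((hmem _).2 ⟨p, h, hp1.2 hv, rfl⟩)
    obtain ⟨h1, h2⟩ := of_notMem_beam (isTreeValue_of_isLeast hV hF) le_rfl hp hpK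
    refine ⟨hall h1 fun s hs => (h2 s hs).trans (hp1.2 hv), fun w hw => ?_⟩
    obtain ⟨s, hs, hsb, rfl⟩ := (hmem w).1 hw
    obtain ⟨hs1, hs2⟩ := value_full hV (hF s) (isPartial_of_mem_beam hs)
    rw [← hp2 hv, ← hs2 (hs1.1 hsb)]
    exact h2 s hs
  · intro hWk
    have h1 : K' = K := by
      rw [hK', List.filter_eq_self]
      rw [hcard] at hWk
      change K.length ≤ k at hlen
      have := List.countP_le_length (l := K) (p := fun s => decide (F s ≤ bound c))
      exact List.countP_eq_length.1 (by omega)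
    have := List.sum_toFinset (M := Fin n → ℚ) id hnodup
    simpa [h1] using this

end Penalty

/-! ### Sums of distinct vertices -/

/-- A set `W` that is not outperformed by any element outside of it minimizes the sum among the sets
of its size: the two sets differ in equally many elements, and those of `W` are the better ones. -/
theorem sum_le_sum_of_best {β : Type*} {W Z : Finset β} {f : β → ℚ} (hcard : W.card = Z.card)
    (h : ∀ z ∈ Z, z ∉ W → ∀ w ∈ W, f w ≤ f z) : ∑ w ∈ W, f w ≤ ∑ z ∈ Z, f z := by
  classical
  rw [← Finset.sum_inter_add_sum_sdiff W Z, ← Finset.sum_inter_add_sum_sdiff Z W,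
    Finset.inter_comm]
  refine add_le_add_right ?_ _
  have hc := Finset.card_sdiff_comm hcard
  rcases (W \ Z).eq_empty_or_nonempty with he | hne
  · rw [he, Finset.card_empty] at hc
    rw [he, Finset.card_eq_zero.1 hc.symm]
  · obtain ⟨a, ha, hmax⟩ := Finset.exists_max_image (W \ Z) f hne
    refine (Finset.sum_le_card_nsmul _ _ _ hmax).trans ?_
    rw [hc]
    refine Finset.card_nsmul_le_sum _ _ _ fun z hz => ?_
    rw [Finset.mem_sdiff] at hz ha
    exact h z hz.1 hz.2 a ha.1

section YQ

variable {n k : ℕ} {Q : Set (Fin n → ℝ)}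

/-- The sum of `k` distinct vertices is in `Y_{k,Q}`: sort them lexicographically. -/
theorem exists_mem_YQ {Z : Finset (Fin n → ℚ)} (hZ : ↑Z ⊆ vertices Q) (hk : Z.card = k) :
    ∃ y ∈ YQ k Q, (fun j => (y j : ℚ)) = ∑ v ∈ Z, v := by
  classical
  let φ : (Fin n → ℚ) → Lex (Fin n → ℕ) := fun v => toLex fun j => if v j = 1 then 1 else 0
  have hφ : ∀ v ∈ Z, (fun j => ((ofLex (φ v) j : ℕ) : ℚ)) = v := by
    intro v hv
    funext j
    rcases (hZ hv).1 j with h | h <;> simp [φ, h]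
  have hinj : Set.InjOn φ Z := by
    intro v hv w hw h
    rw [← hφ v hv, ← hφ w hw, h]
  have hcard : (Z.image φ).card = k := by rw [Finset.card_image_of_injOn hinj, hk]
  have hmem : ∀ i, ∃ v ∈ Z, φ v = (Z.image φ).orderEmbOfFin hcard i := fun i =>
    Finset.mem_image.1 (Finset.orderEmbOfFin_mem _ hcard i)
  refine ⟨∑ i, ofLex ((Z.image φ).orderEmbOfFin hcard i),
    ⟨fun i => ofLex ((Z.image φ).orderEmbOfFin hcard i), ⟨⟨fun i j => ?_, ?_⟩, fun i => ?_⟩, rfl⟩,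
    ?_⟩
  · obtain ⟨v, hv, h⟩ := hmem i
    dsimp only
    rw [← h]
    simp only [φ, ofLex_toLex]
    split
    · exact .inr rfl
    · exact .inl rfl
  · exact ((Z.image φ).orderEmbOfFin hcard).strictMono
  · obtain ⟨v, hv, h⟩ := hmem i
    dsimp only
    rw [← h]
    convert (hZ hv).2 using 1
    funext j
    rw [toReal, ← congrFun (hφ v hv) j]
    simp
  · have h1 : ∑ i, ofLex ((Z.image φ).orderEmbOfFin hcard i) = ∑ v ∈ Z, ofLex (φ v) := by
      rw [← Finset.sum_image (f := fun u => ofLex u) hinj]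
      conv_rhs => rw [← Finset.map_orderEmbOfFin_univ (Z.image φ) hcard, Finset.sum_map]
      rfl
    rw [h1]
    conv_rhs => rw [← Finset.sum_congr rfl hφ]
    funext j
    simp [Finset.sum_apply]

/-- An element of `Y_{k,Q}` is the sum of `k` distinct vertices, as the rows of a matrix in
`L_{k,Q}` are distinct binary points of `Q`. -/
theorem exists_of_mem_YQ {y : Fin n → ℕ} (hy : y ∈ YQ k Q) :
    ∃ Z : Finset (Fin n → ℚ), ↑Z ⊆ vertices Q ∧ Z.card = k ∧
      (fun j => (y j : ℚ)) = ∑ v ∈ Z, v := by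
  classical
  obtain ⟨z, ⟨⟨hbin, hmono⟩, hzQ⟩, rfl⟩ := hy
  let ψ : Fin k → Fin n → ℚ := fun i j => (z i j : ℚ)
  have hinj : Function.Injective ψ := by
    intro i i' h
    refine hmono.injective (toLex.injective.eq_iff.2 ?_)
    funext j
    exact Nat.cast_injective (R := ℚ) (congrFun h j)
  refine ⟨Finset.univ.image ψ, ?_, ?_, ?_⟩
  · intro v hv
    simp only [Finset.coe_image, Finset.coe_univ, Set.image_univ, Set.mem_range] at hv
    obtain ⟨i, rfl⟩ := hv
    refine ⟨fun t => ?_, ?_⟩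
    · rcases hbin i t with h | h <;> simp [ψ, h]
    · convert hzQ i using 1
      funext j
      simp [toReal, ψ]
  · rw [Finset.card_image_of_injective _ hinj, Finset.card_univ, Fintype.card_fin]
  · rw [Finset.sum_image hinj.injOn]
    funext j
    have h : (∑ i, z i) j = ∑ i, z i j := Finset.sum_apply j _ _
    rw [Finset.sum_apply, h, Nat.cast_sum]

end YQ

/-! ### The algorithm -/

section Value

variable {n : ℕ}

/-- The value of a partial sign vector: the optimal value of the penalized objective according to
the optimization oracle `o`, and a value above the bound if the polytope is empty. -/
def value (o : (Fin n → ℚ) → Option (Fin n → ℚ)) (c s : Fin n → ℚ) : ℚ :=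
  if (o (penalized c s)).isSome then objective c s ((o (penalized c s)).getD 0) else bound c + 1

/-- `o` is a correct optimization oracle for `Q`: it maps an objective to a minimizer, and to `none`
if `Q` is empty. The minimizer need not be a vertex. -/
def IsOracle (Q : Set (Fin n → ℝ)) (o : (Fin n → ℚ) → Option (Fin n → ℚ)) : Prop :=
  ∀ c, (o c = none ∧ Q = ∅) ∨ ∃ z, o c = some z ∧ toReal z ∈ Q ∧
    ∀ q ∈ Q, toReal c ⬝ᵥ toReal z ≤ toReal c ⬝ᵥ q

variable {Q : Set (Fin n → ℝ)} {o : (Fin n → ℚ) → Option (Fin n → ℚ)}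

/-- The oracle's optimal value is attained at a vertex, although its minimizer need not be one. -/
theorem isLeast_value (hQ : IsBinaryPolytope Q) (ho : IsOracle Q o) (hne : Q.Nonempty)
    (c s : Fin n → ℚ) : IsLeast (objective c s '' vertices Q) (value o c s) := by
  rcases ho (penalized c s) with ⟨-, h⟩ | ⟨z, hz, hzQ, hmin⟩
  · exact absurd h hne.ne_empty
  · have hval : value o c s = objective c s z := by simp [value, hz]
    have hle : ∀ v ∈ vertices Q, objective c s z ≤ objective c s v := by
      intro v hv
      have := hmin _ hv.2
      rw [toReal_dotProduct, toReal_dotProduct] at this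
      exact add_le_add_left (by exact_mod_cast this) _
    rw [hval]
    obtain ⟨v, hv, hvz⟩ := hQ.exists_vertex_le (penalized c s) hzQ
    refine ⟨⟨v, hv, le_antisymm (add_le_add_left hvz _) (hle v hv)⟩, ?_⟩
    rintro _ ⟨v, hv, rfl⟩
    exact hle v hv

theorem value_of_empty (ho : IsOracle Q o) (hQ : Q = ∅) (c s : Fin n → ℚ) :
    value o c s = bound c + 1 := by
  rcases ho (penalized c s) with ⟨h, -⟩ | ⟨z, -, hz, -⟩
  · simp [value, h]
  · rw [hQ] at hz
    exact absurd hz (Set.notMem_empty _)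

/-- The number of vertices that are found by the search: by `value_full`, these are the members of
the last level whose value does not exceed the bound. -/
def numFound (o : (Fin n → ℚ) → Option (Fin n → ℚ)) (c : Fin n → ℚ) (k : ℕ) : ℕ :=
  (beam (value o c) k n).countP fun s => value o c s ≤ bound c

/-- The sum of the vertices that are found by the search, if there are `k` of them. -/
def sumFound (o : (Fin n → ℚ) → Option (Fin n → ℚ)) (c : Fin n → ℚ) (k : ℕ) : Fin n → ℚ :=
  ((beam (value o c) k n).map vert).sum

/-- If the search finds `k` vertices, then their sum minimizes `c` over `Y_{k,Q}`. -/
theorem sumFound_spec (hQ : IsBinaryPolytope Q) (ho : IsOracle Q o) {c : Fin n → ℚ} {k : ℕ}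
    (hk : 1 ≤ k) (h : k ≤ numFound o c k) :
    (∃ y ∈ YQ k Q, (fun j => (y j : ℚ)) = sumFound o c k) ∧
      ∀ y ∈ YQ k Q, c ⬝ᵥ sumFound o c k ≤ c ⬝ᵥ fun j => (y j : ℚ) := by
  have hne : Q.Nonempty := by
    by_contra hne
    rw [Set.not_nonempty_iff_eq_empty] at hne
    have h0 : numFound o c k = 0 := by
      rw [numFound, List.countP_eq_zero]
      intro s _
      rw [value_of_empty ho hne]
      simp
    omega
  obtain ⟨W, hW, hcard, hbest, hsum⟩ := beam_spec (fun v (hv : v ∈ vertices Q) => hv.1)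
    (isLeast_value hQ ho hne c) hk
  have hWk : W.card = k := by
    refine le_antisymm ?_ (h.trans_eq hcard.symm)
    rw [hcard]
    exact List.countP_le_length.trans (length_beam_le hk n)
  rw [sumFound, ← hsum hWk]
  refine ⟨exists_mem_YQ hW hWk, fun y hy => ?_⟩
  obtain ⟨Z, hZ, hZk, hyZ⟩ := exists_of_mem_YQ hy
  rw [hyZ, dotProduct_sum, dotProduct_sum]
  exact sum_le_sum_of_best (hWk.trans hZk.symm) fun z hz hzW => (hbest z (hZ hz) hzW).2

/-- If the search finds fewer than `k` vertices, then there are fewer than `k` vertices. -/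
theorem YQ_eq_empty (hQ : IsBinaryPolytope Q) (ho : IsOracle Q o) {c : Fin n → ℚ} {k : ℕ}
    (hk : 1 ≤ k) (h : numFound o c k < k) : YQ k Q = ∅ := by
  rw [Set.eq_empty_iff_forall_notMem]
  intro y hy
  obtain ⟨Z, hZ, hZk, -⟩ := exists_of_mem_YQ hy
  obtain ⟨z, hz⟩ := Finset.card_pos.1 (show 0 < Z.card by omega)
  obtain ⟨W, hW, hcard, hbest, -⟩ := beam_spec (fun v (hv : v ∈ vertices Q) => hv.1)
    (isLeast_value hQ ho ⟨_, (hZ hz).2⟩ c) hk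
  change W.card = numFound o c k at hcard
  have hZW : Z ⊆ W := by
    intro v hv
    by_contra hvW
    have := (hbest v (hZ hv) hvW).1
    omega
  have := Finset.card_le_card hZW
  omega

end Value

/-- The unit vector in direction `j`, as a list of length `j + 1`. -/
def unitData : ℕ → Data
  | 0 => .pair (num 1) (num 0)
  | j + 1 => .pair (num 0) (unitData j)

theorem nth_unitData (j t : ℕ) : nth (unitData j) t = num (if t = j then 1 else 0) := by
  induction j generalizing t with
  | zero =>
    cases t with
    | zero => rfl
    | succ t => exact (nth_num_zero t).trans (by simp)
  | succ j ih =>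
    cases t with
    | zero => simp [unitData, nth, Data.hd]
    | succ t =>
      have : nth (unitData (j + 1)) (t + 1) = nth (unitData j) t := rfl
      rw [this, ih]
      simp

theorem size_unitData (j : ℕ) : (unitData j).size = 3 * j + 6 := by
  induction j with
  | zero => rfl
  | succ j ih =>
    have : (num 0).size = 2 := rfl
    rw [unitData, size, ih, this]
    omega

theorem size_ofVec_le {n j : ℕ} {s : Fin n → ℚ} (hs : IsPartial j s) :
    (ofVec s).size ≤ n * 4 + 2 := by
  refine (size_ofList_le (B := 3) fun u hu => ?_).trans_eq (by rw [List.length_ofFn])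
  obtain ⟨t, rfl⟩ := List.mem_ofFn.1 hu
  have h : s t = 1 ∨ s t = -1 ∨ s t = 0 := by
    rcases lt_or_ge t.1 j with ht | ht
    · exact ((hs t).1 ht).imp_right .inl
    · exact .inr (.inr ((hs t).2 ht))
  rcases h with h | h | h <;> rw [h] <;> decide

theorem countP_eq_sum {α : Type*} (p : α → Bool) (K : List α) :
    (K.countP p : ℚ) = ∑ t : Fin K.length, if p K[t] then 1 else 0 := by
  refine Eq.trans ?_ (Fin.sum_univ_fun_getElem K fun s => if p s then (1 : ℚ) else 0).symm
  induction K with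
  | nil => simp
  | cons s K ih =>
    rw [List.countP_cons, List.map_cons, List.sum_cons, ← ih]
    split <;> simp [add_comm]

namespace PolyTime

variable {ι : Type*} {code : ι → Data} {m : ι → ℕ}
  {o : ∀ i, (Fin (m i) → ℚ) → Option (Fin (m i) → ℚ)}

section

variable {I : Type*} {e : I → Data} {n : I → ℕ}

theorem bound {c : ∀ i, Fin (n i) → ℚ} (hc : PolyTime e fun i => ofVec (c i)) :
    PolyTime e fun i => num (bound (c i)) :=
  sum (a := fun i t => num (c i t)) hc (const 0)
    (((refl _).snd.fst.mul (refl _).snd.fst).add (const 1))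

theorem weight {c : ∀ i, Fin (n i) → ℚ} (hc : PolyTime e fun i => ofVec (c i)) :
    PolyTime e fun i => num (2 * PolySep.bound (c i) + 1) :=
  ((const 2).mul hc.bound).add (const 1)

theorem penalized {c s : ∀ i, Fin (n i) → ℚ} (hc : PolyTime e fun i => ofVec (c i))
    (hs : PolyTime e fun i => ofVec (s i)) :
    PolyTime e fun i => ofVec (penalized (c i) (s i)) :=
  axpy hc hc.weight hs fun _ _ => nth_ofVec _ _

theorem offset {c s : ∀ i, Fin (n i) → ℚ} (hc : PolyTime e fun i => ofVec (c i))
    (hs : PolyTime e fun i => ofVec (s i)) :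
    PolyTime e fun i => num (offset (c i) (s i)) :=
  sum (a := fun i t => num (s i t)) hs (const 0)
    ((hc.weight.lift Sigma.fst (refl _).fst).mul
      ((((refl _).snd.fst.mul (refl _).snd.fst).sub (refl _).snd.fst).mul (const (1 / 2))))

theorem vert {s : ∀ i, Fin (n i) → ℚ} (hs : PolyTime e fun i => ofVec (s i)) :
    PolyTime e fun i => ofVec (vert (s i)) :=
  map (a := fun i t => num (s i t)) hs (const 0)
    (((const 1).sub (refl _).snd.fst).mul (const (1 / 2)))

theorem natCast {k : I → ℕ} (hk : PolyTime e fun i => unary (k i)) :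
    PolyTime e fun i => num (k i : ℚ) := by
  have := sum (N := k) (a := fun _ _ => num 0) (b := fun _ _ => 1)
    (by simpa [unary, List.ofFn_const] using hk) (const 0) (const 1)
  simpa using this

end

/-- The optimization oracle `o i` is computed in polynomial time from the description of the `i`-th
polytope and the objective. -/
def OracleInPolyTime (code : ι → Data) (m : ι → ℕ)
    (o : ∀ i, (Fin (m i) → ℚ) → Option (Fin (m i) → ℚ)) : Prop :=
  PolyTime (fun x : Σ i, Fin (m i) → ℚ => .pair (descr code m x.1) (ofVec x.2))
    fun x => ofOption ((o x.1 x.2).map ofVec)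

section

variable {I : Type*} {e : I → Data} {i : I → ι} {c : ∀ x, Fin (m (i x)) → ℚ}

theorem value {s : ∀ x, Fin (m (i x)) → ℚ} (ho : OracleInPolyTime code m o)
    (hd : PolyTime e fun x => descr code m (i x))
    (hc : PolyTime e fun x => ofVec (c x)) (hs : PolyTime e fun x => ofVec (s x)) :
    PolyTime e fun x => num (value (o (i x)) (c x) (s x)) := by
  have hw := ho.lift (fun x => ⟨i x, PolySep.penalized (c x) (s x)⟩) (hd.pair (hc.penalized hs))
  have hz : ∀ x (t : Fin (m (i x))),
      nth (ofOption ((o (i x) (PolySep.penalized (c x) (s x))).map ofVec)).tl t =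
        num ((o (i x) (PolySep.penalized (c x) (s x))).getD 0 t) := by
    intro x t
    -- If the answer is `none`, the list is empty, and it represents the zero vector.
    rcases o (i x) (PolySep.penalized (c x) (s x)) with _ | z
    · exact nth_num_zero t
    · exact nth_ofVec z t
  convert! ite hw.isPair (((hc.penalized hs).dot hw.tl hz).add (hc.offset hs))
    (hc.bound.add (const 1)) using 2 with x
  rw [PolySep.value, objective]
  rcases o (i x) (PolySep.penalized (c x) (s x)) with _ | z <;>
    simp [ofOption, Data.isPair]

theorem node {s : ∀ x, Fin (m (i x)) → ℚ} (ho : OracleInPolyTime code m o)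
    (hd : PolyTime e fun x => descr code m (i x))
    (hc : PolyTime e fun x => ofVec (c x)) (hs : PolyTime e fun x => ofVec (s x)) :
    PolyTime e fun x => node (PolySep.value (o (i x)) (c x)) ofVec (s x) :=
  (value ho hd hc hs).pair hs

theorem beam {k : I → ℕ} (ho : OracleInPolyTime code m o) (hk1 : ∀ x, 1 ≤ k x)
    (hd : PolyTime e fun x => descr code m (i x))
    (hc : PolyTime e fun x => ofVec (c x)) (hk : PolyTime e fun x => unary (k x)) :
    PolyTime e fun x => nodes (PolySep.value (o (i x)) (c x)) ofVec
      (beam (PolySep.value (o (i x)) (c x)) (k x) (m (i x))) := by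
  have hm : PolyTime e fun x => unary (m (i x)) := hd.fst
  have hmB : PolyBdd (fun x => (e x).size) fun x => m (i x) :=
    hm.size_le.mono fun x => by
      simpa [unary] using length_le_size (List.replicate (m (i x)) (num 0))
  have hkB : PolyBdd (fun x => (e x).size) k :=
    hk.size_le.mono fun x => by
      simpa [unary] using length_le_size (List.replicate (k x) (num 0))
  let F := fun x => PolySep.value (o (i x)) (c x)
  let st : I → ℕ → Data := fun x j =>
    .pair (unitData j) (nodes (F x) ofVec (PolySep.beam (F x) (k x) j))
  refine (fold (e := e) (N := fun x => m (i x)) (a := fun _ _ => num 0) (d := fun _ => num 0)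
    (s := st) (by simpa [unary, List.ofFn_const] using hm) (const 0) ?_ ?_ ?_).snd
  · have h0 : PolyTime e fun x => ofVec (0 : Fin (m (i x)) → ℚ) := by
      simpa only [ofVec_zero] using hm
    exact ((const 1).pair (const 0)).pair ((node ho hd hc h0).pair (const 0))
  · let e' := fun x : Σ x, Fin (m (i x)) => Data.pair (e x.1)
      (.pair (.pair (num 0) (nth (num 0) x.2)) (st x.1 x.2))
    have hu : PolyTime e' fun x => unitData x.2 := (refl e').snd.snd.fst
    have hK : PolyTime e' fun x => nodes (F x.1) ofVec (PolySep.beam (F x.1) (k x.1) x.2) :=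
      (refl e').snd.snd.snd
    have he : PolyTime e' fun x => e x.1 := (refl e').fst
    let e'' := fun y : Σ x : (Σ x, Fin (m (i x))), Fin (PolySep.beam (F x.1) (k x.1) x.2).length =>
      Data.pair (e' y.1) (PolySep.node (F y.1.1) ofVec
        (PolySep.beam (F y.1.1) (k y.1.1) y.1.2)[y.2])
    have he' : PolyTime e'' fun y => e' y.1 := (refl e'').fst
    have hs : PolyTime e'' fun y => ofVec (PolySep.beam (F y.1.1) (k y.1.1) y.1.2)[y.2] :=
      (refl e'').snd.snd
    have hchild : ∀ q : ℚ, PolyTime e'' fun y => PolySep.node (F y.1.1) ofVec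
        (child y.1.2 q (PolySep.beam (F y.1.1) (k y.1.1) y.1.2)[y.2]) := by
      intro q
      exact node ho (i := fun y => i y.1.1) (c := fun y => c y.1.1)
        ((hd.lift Sigma.fst he).lift Sigma.fst he') ((hc.lift Sigma.fst he).lift Sigma.fst he')
        (axpy hs (const q) (hu.lift Sigma.fst he') fun _ _ => nth_unitData _ _)
    exact ((const 0).pair hu).pair (level hK (hchild 1) (hchild (-1))
      (hk.natCast.lift Sigma.fst he))
  -- The states have polynomial size in every round: there are at most `k` nodes, and each of them
  -- is computed from the input and a vector with entries `0`, `1` and `-1`.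
  · have hnode : PolyTime (fun y : Σ x, {s : Fin (m (i x)) → ℚ // ∃ j, IsPartial j s} =>
        .pair (e y.1) (ofVec y.2.1)) fun y => PolySep.node (F y.1) ofVec y.2.1 :=
      node ho (hd.lift Sigma.fst (refl _).fst) (hc.lift Sigma.fst (refl _).fst) (refl _).snd
    have hsize : PolyBdd (fun y : Σ x, {s : Fin (m (i x)) → ℚ // ∃ j, IsPartial j s} =>
        (e y.1).size) fun y => (Data.pair (e y.1) (ofVec y.2.1)).size := by
      refine PolyBdd.mono (((PolyBdd.refl fun x => (e x).size).add
        ((hmB.mul (.const 4)).add (.const 3))).comp Sigma.fst) ?_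
      rintro ⟨x, s, j, hs⟩
      have := size_ofVec_le hs
      simp only [size]
      omega
    obtain ⟨P, hP⟩ := hsize.trans hnode.size_le
    refine PolyBdd.mono ((((hmB.mul (.const 3)).add (.const 9)).add
      ((hkB.mul (.add ⟨P, fun _ => le_rfl⟩ (.const 1))))).comp Sigma.fst) ?_
    rintro ⟨x, j, hj⟩
    have h1 := size_unitData j
    have h2 : (nodes (F x) ofVec (PolySep.beam (F x) (k x) j)).size ≤
        k x * (P.eval (e x).size + 1) + 2 := by
      refine (size_ofList_le (B := P.eval (e x).size) fun u hu => ?_).trans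
        (Nat.add_le_add_right (Nat.mul_le_mul_right _ ?_) _)
      · obtain ⟨s, hs, rfl⟩ := List.mem_map.1 hu
        exact hP ⟨x, s, j, isPartial_of_mem_beam hs⟩
      · rw [List.length_map]
        exact length_beam_le (hk1 x) j
    dsimp only
    simp only [st, size, h1]
    omega

theorem numFound {k : I → ℕ} (ho : OracleInPolyTime code m o) (hk1 : ∀ x, 1 ≤ k x)
    (hd : PolyTime e fun x => descr code m (i x))
    (hc : PolyTime e fun x => ofVec (c x)) (hk : PolyTime e fun x => unary (k x)) :
    PolyTime e fun x => num (numFound (o (i x)) (c x) (k x) : ℚ) := by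
  have hK := beam ho hk1 hd hc hk
  simp only [nodes_eq_ofFn] at hK
  have := sum hK (const 0) (b := fun x t => if decide (PolySep.value (o (i x)) (c x)
    (PolySep.beam (PolySep.value (o (i x)) (c x)) (k x) (m (i x)))[t] ≤ PolySep.bound (c x))
      then 1 else 0) ?_
  · convert! this using 3 with x
    exact countP_eq_sum _ _
  · simp only [apply_ite num]
    exact ite ((refl _).snd.fst.fst.le (hc.bound.lift Sigma.fst (refl _).fst)) (const 1) (const 0)

theorem sumFound {k : I → ℕ} (ho : OracleInPolyTime code m o) (hk1 : ∀ x, 1 ≤ k x)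
    (hd : PolyTime e fun x => descr code m (i x))
    (hc : PolyTime e fun x => ofVec (c x)) (hk : PolyTime e fun x => unary (k x)) :
    PolyTime e fun x => ofVec (sumFound (o (i x)) (c x) (k x)) := by
  have hK := beam ho hk1 hd hc hk
  simp only [nodes_eq_ofFn] at hK
  have := vecSum hK (const 0) hd.fst (b := fun x t => PolySep.vert
    (PolySep.beam (PolySep.value (o (i x)) (c x)) (k x) (m (i x)))[t])
    (vert (refl _).snd.fst.snd)
  convert! this using 3 with x
  exact (Fin.sum_univ_fun_getElem _ _).symm

end

end PolyTime

namespace Instance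

variable {ι : Type*} {code : ι → Data} {m : ι → ℕ}

/-- The objective on the sums `y` that is given by the left-hand side `xᵀ A y`. -/
def cost (I : Instance m) : Fin (m I.i) → ℚ := ∑ r, fun t => I.A r t * I.x r

theorem cost_dotProduct (I : Instance m) (y : Fin (m I.i) → ℚ) :
    I.cost ⬝ᵥ y = I.x ⬝ᵥ I.A.mulVec y := by
  rw [cost, sum_dotProduct]
  simp only [dotProduct, Matrix.mulVec, Finset.mul_sum]
  exact Finset.sum_congr rfl fun r _ => Finset.sum_congr rfl fun t _ => by ring

theorem polyTime_cost : PolyTime (encode (m := m) code) fun I => ofVec I.cost := by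
  have he := PolyTime.refl (encode (m := m) code)
  refine PolyTime.vecSum (N := fun I => I.n) (a := fun I r => ofVec (I.A r))
    (d := fun I => ofVec I.x) he.snd.snd.fst he.snd.snd.snd.snd.snd.fst he.fst.fst ?_
  refine PolyTime.map (a := fun x t => num (x.1.A x.2 t)) (PolyTime.refl _).snd.fst (.const 0) ?_
  simp only [nth_ofVec]
  exact (PolyTime.refl _).snd.fst.mul (PolyTime.refl _).fst.snd.snd

end Instance

/-- The answers of an optimization program form an oracle that is computable in polynomial time. -/
theorem exists_oracle {ι : Type*} {code : ι → Data} {m : ι → ℕ}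
    {Q : ∀ i, Set (Fin (m i) → ℝ)} (hQ : OptimizableInPolyTime code m Q) :
    ∃ o : ∀ i, (Fin (m i) → ℚ) → Option (Fin (m i) → ℚ),
      (∀ i, IsOracle (Q i) (o i)) ∧ PolyTime.OracleInPolyTime code m o := by
  obtain ⟨p, P, hp⟩ := hQ
  choose w t hw ht hans using hp
  have key : ∀ i (c : Fin (m i) → ℚ), ∃ z : Option (Fin (m i) → ℚ),
      w ⟨i, c⟩ = ofOption (z.map ofVec) ∧ ((z = none ∧ Q i = ∅) ∨ ∃ z', z = some z' ∧
        toReal z' ∈ Q i ∧ ∀ q ∈ Q i, toReal c ⬝ᵥ toReal z' ≤ toReal c ⬝ᵥ q) := by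
    intro i c
    rcases hans ⟨i, c⟩ with ⟨h1, h2⟩ | ⟨z, h1, h2⟩
    · exact ⟨none, h1, .inl ⟨rfl, h2⟩⟩
    · exact ⟨some z, h1, .inr ⟨z, rfl, h2⟩⟩
  choose o ho ho' using key
  exact ⟨o, ho', p, t, fun x => by
    have := hw ⟨x.1, x.2⟩
    rwa [ho x.1 x.2] at this, P, ht⟩

end PolySep

theorem mainTheorem2 {ι : Type*} (code : ι → PolySep.Data) (m : ι → ℕ)
    (Q : ∀ i, Set (Fin (m i) → ℝ)) (hQ : PolySep.IsTractableBinary code m Q) :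
    PolySep.SolvableInPolyTime (PolySep.Instance.encode (m := m) code)
      (PolySep.Instance.Answer Q) := by
  open PolySep Data in
  obtain ⟨o, ho, ho'⟩ := exists_oracle hQ.optimizable
  have he := PolyTime.refl (Instance.encode (m := m) code)
  have hc := Instance.polyTime_cost (m := m) (code := code)
  have hn := PolyTime.numFound ho' Instance.k_pos he.fst hc he.snd.fst
  have hs := PolyTime.sumFound ho' Instance.k_pos he.fst hc he.snd.fst
  have hk := he.snd.fst.natCast
  have habar := he.snd.snd.snd.fst
  have hb := he.snd.snd.snd.snd.fst
  have hx := he.snd.snd.snd.snd.snd.fst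
  have hsat := (hk.mul hb).le ((hc.dot hs fun _ _ => nth_ofVec _ _).add
    (hk.mul (habar.dot hx fun _ _ => nth_ofVec _ _)))
  obtain ⟨p, t, hp, P, hP⟩ := PolyTime.ite (hk.le hn)
    (.ite hsat (.const 0) ((PolyTime.const 1).pair hs)) (.const 0)
  refine ⟨p, P, fun I => ⟨_, t I, hp I, hP I, ?_⟩⟩
  simp only [decide_eq_true_eq, Nat.cast_le]
  split
  · rename_i hk
    obtain ⟨⟨y, hy, hys⟩, hmin⟩ := sumFound_spec (hQ.binary I.i) (ho I.i) I.k_pos hk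
    split
    · rename_i hle
      refine .inl ⟨rfl, fun y hy => ?_⟩
      rw [Instance.Satisfies, ← Instance.cost_dotProduct]
      exact hle.trans (add_le_add_left (hmin y hy) _)
    · rename_i hle
      refine .inr ⟨y, hy, ?_, ?_⟩
      · rw [Instance.Satisfies, ← Instance.cost_dotProduct, hys]
        exact hle
      · rw [hys]
        rfl
  -- There are fewer than `k` vertices, hence no inequalities.
  · rename_i hk
    refine .inl ⟨rfl, fun y hy => ?_⟩
    rw [YQ_eq_empty (hQ.binary I.i) (ho I.i) I.k_pos (not_le.1 hk)] at hy
    exact absurd hy (Set.notMem_empty y)
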